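/- An instance of \textsc{Max Happy Vertices} consists of a finite simple undirected graph $G=(V,E)$, a number $\ell$ of colors, a partial coloring $p:S\to[\ell]$ with $S\subseteq V$, and a positive integer $k$. For a coloring $c:V\to[\ell]$, a vertex $v$ is \emph{happy} if $c(u)=c(v)$ for every neighbor $u$ of $v$. The question is whether some coloring $c:V\to[\ell]$ extending $p$ makes at least $k$ vertices happy. \textbf{Lemma.} \textsc{Max Happy Vertices} is fixed-parameter tractable when parameterized by $k$ and $\ell$: there are an algorithm, a computable function $f$ and a constant $d$ such that the algorithm decides every instance $I$ in at most $f(k+\ell)\cdot|I|^{d}$ steps, where $|I|$ is the length of the encoding of $I$ as a word over a fixed finite alphabet (graph given by its adjacency matrix, numbers in binary) and steps are those of a random access machine with addition, subtraction and comparison at unit cost. Moreover, let $\ell\ge 1$, and call a vertex $v$ \emph{potentially happy} if its closed neighborhood $N[v]$ does not contain two precolored vertices of different colors. Let $P$ be the set of potentially happy vertices, $S_H=P\cap S$ and $Q_H=P\setminus S$, and let $G'$ be the graph obtained from $G$ by deleting all edges with both endpoints outside $P$. Then: \begin{enumerate} \item if for some color $j$ at least $k$ vertices of $S_H$ are precolored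 $j$, then the instance is a Yes-instance; \item if $|Q_H|\ge \ell k$, then the instance is a Yes-instance; \item every vertex that is happy with respect to some coloring extending $p$ lies in $P$; \item if neither the hypothesis of (1) nor that of (2) holds, then $P$ is a vertex cover of $G'$ and $|P|\le 2\ell k$; \item the instance is a Yes-instance if and only if there is a coloring $c:V\to[\ell]$ extending $p$ such that at least $k$ vertices of $P$ are happy in $G'$ with respect to $c$. \end{enumerate} -/

import Mathlib

/-! ### A random access machine with a step count -/

namespace RAM

/-- A state of the machine: registers `reg 0, reg 1, …` and memories `mem 0, mem 1, …`, each memory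
being an array of cells indexed by the natural numbers. Registers and cells hold natural numbers.
A program mentions only finitely many registers and memories. -/
structure State where
  reg : ℕ → ℕ
  mem : ℕ → ℕ → ℕ

/-- Expressions: constants, registers, indirect reading of a memory cell, addition, truncated
subtraction and comparison. (There is no multiplication, so that unit cost is polynomially
equivalent to Turing machine time.) -/
inductive Expr where
  | const (n : ℕ)
  | reg (x : ℕ)
  | load (a : ℕ) (i : Expr)
  | add (e₁ e₂ : Expr)
  | sub (e₁ e₂ : Expr)
  | lt (e₁ e₂ : Expr)

/-- The value of an expression; a comparison has value `1` if it holds and `0` otherwise. -/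
def Expr.eval (s : State) : Expr → ℕ
  | .const n => n
  | .reg x => s.reg x
  | .load a i => s.mem a (i.eval s)
  | .add e₁ e₂ => e₁.eval s + e₂.eval s
  | .sub e₁ e₂ => e₁.eval s - e₂.eval s
  | .lt e₁ e₂ => if e₁.eval s < e₂.eval s then 1 else 0

/-- The number of unit steps needed to evaluate an expression. -/
def Expr.cost : Expr → ℕ
  | .const _ => 1
  | .reg _ => 1
  | .load _ i => i.cost + 1
  | .add e₁ e₂ => e₁.cost + e₂.cost + 1
  | .sub e₁ e₂ => e₁.cost + e₂.cost + 1
  | .lt e₁ e₂ => e₁.cost + e₂.cost + 1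

/-- Programs. Conditions are expressions, read as true when their value is nonzero. -/
inductive Program where
  | skip
  | assign (x : ℕ) (e : Expr)
  | store (a : ℕ) (i e : Expr)
  | seq (P Q : Program)
  | ite (e : Expr) (P Q : Program)
  | loop (e : Expr) (P : Program)

/-- Write the value `n` into register `x`. -/
def State.setReg (s : State) (x n : ℕ) : State :=
  { s with reg := Function.update s.reg x n }

/-- Write the value `n` into cell `i` of memory `a`. -/
def State.setMem (s : State) (a i n : ℕ) : State :=
  { s with mem := Function.update s.mem a (Function.update (s.mem a) i n) }

/-- `Exec P s t s'`: started in the state `s`, the program `P` halts in the state `s'` after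
exactly `t` steps. -/
inductive Exec : Program → State → ℕ → State → Prop where
  | skip (s : State) : Exec .skip s 1 s
  | assign (s : State) (x : ℕ) (e : Expr) :
      Exec (.assign x e) s (e.cost + 1) (s.setReg x (e.eval s))
  | store (s : State) (a : ℕ) (i e : Expr) :
      Exec (.store a i e) s (i.cost + e.cost + 1) (s.setMem a (i.eval s) (e.eval s))
  | seq {P Q : Program} {s s' s'' : State} {t t' : ℕ} :
      Exec P s t s' → Exec Q s' t' s'' → Exec (.seq P Q) s (t + t') s''
  | ite_true {e : Expr} {P Q : Program} {s s' : State} {t : ℕ} :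
      e.eval s ≠ 0 → Exec P s t s' → Exec (.ite e P Q) s (e.cost + 1 + t) s'
  | ite_false {e : Expr} {P Q : Program} {s s' : State} {t : ℕ} :
      e.eval s = 0 → Exec Q s t s' → Exec (.ite e P Q) s (e.cost + 1 + t) s'
  | loop_done {e : Expr} {P : Program} {s : State} :
      e.eval s = 0 → Exec (.loop e P) s (e.cost + 1) s
  | loop_step {e : Expr} {P : Program} {s s' s'' : State} {t t' : ℕ} :
      e.eval s ≠ 0 → Exec P s t s' → Exec (.loop e P) s' t' s'' →
      Exec (.loop e P) s (e.cost + 1 + t + t') s''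

/-- The starting state on an input word over the alphabet `{0, …, σ - 1}`: register `0` holds the
length of the word, memory `0` holds its letters, everything else is `0`. -/
def inputState {σ : ℕ} (w : List (Fin σ)) : State where
  reg := fun x => if x = 0 then w.length else 0
  mem := fun a i => if a = 0 then (w.map Fin.val).getD i 0 else 0

end RAM

/-- A parameterized decision problem, with instances `α` presented as words over a finite alphabet
by `enc`, parameter `κ` and set of Yes-instances `Yes`, is fixed-parameter tractable: one
program decides every instance `a` in at most `f (κ a) * |enc a| ^ d` steps, for a computable
function `f` and a constant `d`. The program answers Yes when register `0` is nonzero on halting. -/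
def FixedParameterTractable {α : Type} {σ : ℕ} (enc : α → List (Fin σ)) (κ : α → ℕ)
    (Yes : α → Prop) : Prop :=
  ∃ (P : RAM.Program) (f : ℕ → ℕ) (d : ℕ), Computable f ∧
    ∀ a : α, ∃ (t : ℕ) (s : RAM.State),
      RAM.Exec P (RAM.inputState (enc a)) t s ∧
      t ≤ f (κ a) * (enc a).length ^ d ∧
      (s.reg 0 ≠ 0 ↔ Yes a)

/-! ### Happy vertices -/

/-- A vertex is happy with respect to a coloring if all its neighbors have its color. -/
def IsHappy {V C : Type} (G : SimpleGraph V) (c : V → C) (v : V) : Prop :=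
  ∀ u, G.Adj v u → c u = c v

/-- A total coloring `c` extends a partial coloring `p` (`p v = none`: `v` is not precolored). -/
def Extends {V C : Type} (p : V → Option C) (c : V → C) : Prop :=
  ∀ v j, p v = some j → c v = j

/-- An instance of Max Happy Vertices: a finite simple graph, a number `ℓ` of colors, a partial
coloring of the vertices with the colors, and a positive integer `k`. -/
structure MaxHappyVertices where
  n : ℕ
  G : SimpleGraph (Fin n)
  ℓ : ℕ
  p : Fin n → Option (Fin ℓ)
  k : ℕ
  k_pos : 0 < k

namespace MaxHappyVertices

/-- Yes-instances: some coloring extending `p` makes at least `k` vertices happy. -/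
def IsYes (I : MaxHappyVertices) : Prop :=
  ∃ c : Fin I.n → Fin I.ℓ, Extends I.p c ∧ I.k ≤ {v | IsHappy I.G c v}.ncard

open Classical in
/-- The numbers describing an instance: `n`, `ℓ`, `k`, the adjacency matrix row by row, and then for
each vertex `0` if it is not precolored and `j + 1` if it has the color `j ∈ {0, …, ℓ - 1}`. -/
noncomputable def numbers (I : MaxHappyVertices) : List ℕ :=
  [I.n, I.ℓ, I.k] ++
    ((List.finRange I.n).flatMap fun u =>
      (List.finRange I.n).map fun v => if I.G.Adj u v then 1 else 0) ++
    (List.finRange I.n).map fun v => (I.p v).elim 0 fun j => (j : ℕ) + 1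

/-- The word presenting an instance: the numbers in binary (least significant bit first), each
followed by the separator `2`. -/
noncomputable def encode (I : MaxHappyVertices) : List (Fin 3) :=
  I.numbers.flatMap fun a => (Nat.bits a).map (fun b => if b then 1 else 0) ++ [2]

/-- A vertex is potentially happy if its closed neighborhood contains no two precolored vertices
of different colors. -/
def IsPotentiallyHappy (I : MaxHappyVertices) (v : Fin I.n) : Prop :=
  ∀ u w, (u = v ∨ I.G.Adj v u) → (w = v ∨ I.G.Adj v w) →
    ∀ i j, I.p u = some i → I.p w = some j → i = j

/-- The potentially happy vertices. -/
def potentiallyHappy (I : MaxHappyVertices) : Set (Fin I.n) :=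
  {v | I.IsPotentiallyHappy v}

/-- The potentially happy vertices that are precolored with the color `j`. -/
def potentiallyHappyColored (I : MaxHappyVertices) (j : Fin I.ℓ) : Set (Fin I.n) :=
  {v | I.IsPotentiallyHappy v ∧ I.p v = some j}

/-- The potentially happy vertices that are not precolored. -/
def potentiallyHappyUncolored (I : MaxHappyVertices) : Set (Fin I.n) :=
  {v | I.IsPotentiallyHappy v ∧ I.p v = none}

/-- The graph obtained by deleting every edge that has no potentially happy endpoint. -/
def reducedGraph (I : MaxHappyVertices) : SimpleGraph (Fin I.n) :=
  I.G.deleteEdges {e | ∀ v ∈ e, v ∉ I.potentiallyHappy}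

end MaxHappyVertices

/-! Call a color `j` compatible with a vertex `v` if every precolored vertex of `N[v]` has color
`j`. Two facts carry the proof. If `k` vertices are compatible with one color `j`, giving `j` to all
vertices that are not precolored makes them all happy (`isYes_of_le_ncard_compatible`). Conversely,
a vertex happy under an extension of `p` is compatible with its own color (`compatible_of_isHappy`).
Items (1) and (2) follow from the first fact, (2) by pigeonhole over the colors; item (3) follows
from the second, and (5) because deleting edges outside `P` changes no neighborhood of a vertex of
`P`.

Tractability is proved without the vertex cover of (4). The machine lists all compatible pairs
(vertex, color). With at least `T = 2 ^ (k + ℓ) ≥ ℓ * k` pairs, pigeonhole gives `k` vertices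
compatible with one color, so the answer is Yes (`isYes_of_many_pairs`). Otherwise it tries all
`k`-tuples of list positions, coded as the numbers below `T ^ k` in base `T`. A tuple succeeds if
its vertices are distinct and any two of them with a common vertex in their closed neighborhoods
have the same color. Then the demands on the closed neighborhoods glue to one coloring
(`isYes_of_not_bad`); conversely, `k` happy vertices yield such a tuple (`IsYes.accepts`).

The running time is a polynomial of degree two in the input length whose coefficients depend only on
`k` and `ℓ`. -/

namespace RAM

/-! ### Total correctness with time bounds -/

@[simp] theorem State.setReg_reg (s : State) (x n y : ℕ) :
    (s.setReg x n).reg y = if y = x then n else s.reg y := by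
  simp [State.setReg, Function.update_apply]

@[simp] theorem State.setReg_mem (s : State) (x n : ℕ) : (s.setReg x n).mem = s.mem := rfl

@[simp] theorem State.setMem_reg (s : State) (a i n : ℕ) : (s.setMem a i n).reg = s.reg := rfl

@[simp] theorem State.setMem_mem (s : State) (a i n b j : ℕ) :
    (s.setMem a i n).mem b j = if b = a ∧ j = i then n else s.mem b j := by
  by_cases h : b = a
  · subst h; simp [State.setMem, Function.update_apply]
  · simp [State.setMem, h]

/-- Started in `s`, the program `P` halts within `T` steps in a state satisfying `Q`. -/
def Run (P : Program) (s : State) (T : ℕ) (Q : State → Prop) : Prop :=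
  ∃ t s', Exec P s t s' ∧ t ≤ T ∧ Q s'

/-- The registers a program may write. -/
def Program.writesReg : Program → ℕ → Bool
  | .skip, _ => false
  | .assign x _, y => x == y
  | .store _ _ _, _ => false
  | .seq P Q, y => P.writesReg y || Q.writesReg y
  | .ite _ P Q, y => P.writesReg y || Q.writesReg y
  | .loop _ P, y => P.writesReg y

/-- The memories a program may write. -/
def Program.writesMem : Program → ℕ → Bool
  | .skip, _ => false
  | .assign _ _, _ => false
  | .store a _ _, b => a == b
  | .seq P Q, y => P.writesMem y || Q.writesMem y
  | .ite _ P Q, y => P.writesMem y || Q.writesMem y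
  | .loop _ P, y => P.writesMem y

/-- The states `s` and `s'` differ only where `P` may write. -/
structure Agree (P : Program) (s s' : State) : Prop where
  reg : ∀ y, P.writesReg y = false → s'.reg y = s.reg y
  mem : ∀ a, P.writesMem a = false → s'.mem a = s.mem a

theorem Agree.refl (P : Program) (s : State) : Agree P s s := ⟨fun _ _ => rfl, fun _ _ => rfl⟩

theorem Agree.trans {P : Program} {s s' s'' : State} (h : Agree P s s') (h' : Agree P s' s'') :
    Agree P s s'' :=
  ⟨fun y hy => (h'.reg y hy).trans (h.reg y hy), fun a ha => (h'.mem a ha).trans (h.mem a ha)⟩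

/-- This is the frame rule. As the write sets are computed by Boolean functions, that a given
register or memory survives a concrete program is proved by `rfl` or `decide`. -/
theorem Exec.agree {P : Program} {s s' : State} {t : ℕ} (h : Exec P s t s') : Agree P s s' := by
  induction h with
  | skip s => exact Agree.refl _ _
  | assign s x e =>
    refine ⟨fun y hy => ?_, fun _ _ => rfl⟩
    have : y ≠ x := by
      rintro rfl
      simp [Program.writesReg] at hy
    simp [this]
  | store s a i e =>
    refine ⟨fun _ _ => rfl, fun b hb => ?_⟩
    have : b ≠ a := by
      rintro rfl
      simp [Program.writesMem] at hb
    funext j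
    simp [this]
  | seq _ _ h₁ h₂ =>
    refine ⟨fun y hy => ?_, fun a ha => ?_⟩
    · simp only [Program.writesReg, Bool.or_eq_false_iff] at hy
      rw [h₂.reg y hy.2, h₁.reg y hy.1]
    · simp only [Program.writesMem, Bool.or_eq_false_iff] at ha
      rw [h₂.mem a ha.2, h₁.mem a ha.1]
  | ite_true _ _ h =>
    refine ⟨fun y hy => ?_, fun a ha => ?_⟩
    · simp only [Program.writesReg, Bool.or_eq_false_iff] at hy
      exact h.reg y hy.1
    · simp only [Program.writesMem, Bool.or_eq_false_iff] at ha
      exact h.mem a ha.1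
  | ite_false _ _ h =>
    refine ⟨fun y hy => ?_, fun a ha => ?_⟩
    · simp only [Program.writesReg, Bool.or_eq_false_iff] at hy
      exact h.reg y hy.2
    · simp only [Program.writesMem, Bool.or_eq_false_iff] at ha
      exact h.mem a ha.2
  | loop_done _ => exact Agree.refl _ _
  | loop_step _ _ _ h₁ h₂ =>
    exact ⟨fun y hy => (h₂.reg y hy).trans (h₁.reg y hy),
      fun a ha => (h₂.mem a ha).trans (h₁.mem a ha)⟩

/-- The frame information `Agree P s s'` is supplied to the weakening step, so postconditions only
need to mention what a program changes. -/
theorem Run.mono {P : Program} {s : State} {T T' : ℕ} {Q Q' : State → Prop} (h : Run P s T Q)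
    (hT : T ≤ T') (hQ : ∀ s', Agree P s s' → Q s' → Q' s') : Run P s T' Q' := by
  obtain ⟨t, s', he, ht, hq⟩ := h
  exact ⟨t, s', he, ht.trans hT, hQ s' he.agree hq⟩

theorem Run.seq {P R : Program} {s : State} {T T' : ℕ} {Q : State → Prop}
    (h : Run P s T fun s' => Run R s' T' Q) : Run (.seq P R) s (T + T') Q := by
  obtain ⟨t, s', he, ht, t', s'', he', ht', hq⟩ := h
  exact ⟨_, _, .seq he he', by omega, hq⟩

theorem Run.seq_of {P R : Program} {s : State} {T T' : ℕ} {Q' Q : State → Prop}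
    (h : Run P s T Q') (h' : ∀ s', Agree P s s' → Q' s' → Run R s' T' Q) :
    Run (.seq P R) s (T + T') Q :=
  (h.mono le_rfl h').seq

theorem Run.assign {x : ℕ} {e : Expr} {s : State} {Q : State → Prop}
    (h : Q (s.setReg x (e.eval s))) : Run (.assign x e) s (e.cost + 1) Q :=
  ⟨_, _, .assign s x e, le_rfl, h⟩

theorem Run.ite {P R : Program} {e : Expr} {s : State} {T : ℕ} {Q : State → Prop}
    (h : e.eval s ≠ 0 → Run P s T Q) (h' : e.eval s = 0 → Run R s T Q) :
    Run (.ite e P R) s (e.cost + 1 + T) Q := by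
  by_cases he : e.eval s = 0
  · obtain ⟨t, s', hx, ht, hq⟩ := h' he
    exact ⟨_, _, .ite_false he hx, by omega, hq⟩
  · obtain ⟨t, s', hx, ht, hq⟩ := h he
    exact ⟨_, _, .ite_true he hx, by omega, hq⟩

/-! ### Programs without loops -/

/-- Whether a program has no loops. -/
def Program.straight : Program → Bool
  | .seq P Q => P.straight && Q.straight
  | .ite _ P Q => P.straight && Q.straight
  | .loop _ _ => false
  | _ => true

/-- The final state of a program without loops. -/
def Program.denote : Program → State → State
  | .skip, s => s
  | .assign x e, s => s.setReg x (e.eval s)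
  | .store a i e, s => s.setMem a (i.eval s) (e.eval s)
  | .seq P Q, s => Q.denote (P.denote s)
  | .ite e P Q, s => if e.eval s = 0 then Q.denote s else P.denote s
  | .loop _ _, s => s

/-- A bound on the number of steps of a program without loops. -/
def Program.time : Program → ℕ
  | .skip => 1
  | .assign _ e => e.cost + 1
  | .store _ i e => i.cost + e.cost + 1
  | .seq P Q => P.time + Q.time
  | .ite e P Q => e.cost + 1 + (P.time + Q.time)
  | .loop _ _ => 0

theorem Run.straight {P : Program} (hP : P.straight = true) {s : State} {Q : State → Prop}
    (h : Q (P.denote s)) : Run P s P.time Q := by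
  suffices H : Run P s P.time (· = P.denote s) from H.mono le_rfl fun _ _ hs => hs ▸ h
  clear h Q
  induction P generalizing s with
  | skip => exact ⟨_, _, .skip s, le_rfl, rfl⟩
  | assign x e => exact Run.assign rfl
  | store a i e => exact ⟨_, _, .store s a i e, le_rfl, rfl⟩
  | seq P R ihP ihR =>
    simp only [Program.straight, Bool.and_eq_true] at hP
    refine Run.seq_of (ihP hP.1) fun s' _ hs => ?_
    subst hs
    exact ihR hP.2
  | ite e P R ihP ihR =>
    simp only [Program.straight, Bool.and_eq_true] at hP
    -- `Program.time` charges both branches of a conditional, so either one fits the bound.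
    refine Run.ite (fun he => (ihP hP.1).mono (Nat.le_add_right _ _) fun _ _ hs => ?_)
      (fun he => (ihR hP.2).mono (Nat.le_add_left _ _) fun _ _ hs => ?_)
    · simp [Program.denote, he, hs]
    · simp [Program.denote, he, hs]
  | loop e P => simp [Program.straight] at hP

/-! ### Counting loops -/

/-- `for i < b do P`, for registers `i` and `b`. -/
def forLoop (i b : ℕ) (P : Program) : Program :=
  .seq (.assign i (.const 0))
    (.loop (.lt (.reg i) (.reg b)) (.seq P (.assign i (.add (.reg i) (.const 1)))))

/-- A round costs 4 for the test and 4 for the increment besides the body; initialization and the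
last test cost 2 + 4. The side conditions are Boolean equations so that concrete programs settle
them by `rfl`. The body may rely on `Agree` with the state before the loop, so the invariant need
not list what the loop leaves untouched. -/
theorem Run.forLoop {i b : ℕ} {P : Program} {s : State} {B T : ℕ} (Inv : ℕ → State → Prop)
    (hi : P.writesReg i = false) (hb : (i == b || P.writesReg b) = false) (hB : s.reg b = B)
    (h0 : Inv 0 (s.setReg i 0))
    (hstep : ∀ j < B, ∀ s', Agree (forLoop i b P) s s' → s'.reg i = j → Inv j s' →
      Run P s' T fun s'' => Inv (j + 1) (s''.setReg i (j + 1))) :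
    Run (forLoop i b P) s (B * (T + 8) + 6) (Inv B) := by
  have hb' := hb
  rw [Bool.or_eq_false_iff, beq_eq_false_iff_ne] at hb'
  have hbF : (RAM.forLoop i b P).writesReg b = false := by
    simpa [RAM.forLoop, Program.writesReg, hb'.2] using hb'.1
  suffices H : ∀ m j s', m + j = B → Agree (RAM.forLoop i b P) s s' → s'.reg i = j → Inv j s' →
      Run (.loop (.lt (.reg i) (.reg b)) (.seq P (.assign i (.add (.reg i) (.const 1))))) s'
        (m * (T + 8) + 4) (Inv B) by
    have hA : Agree (RAM.forLoop i b P) s (s.setReg i 0) := by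
      refine ⟨fun y hy => ?_, fun _ _ => rfl⟩
      have : y ≠ i := by
        rintro rfl
        simp [RAM.forLoop, Program.writesReg] at hy
      simp [this]
    have := Run.seq (Run.assign (x := i) (e := .const 0) (by simpa [Expr.eval] using H B 0 _ rfl hA (by simp) h0))
    exact this.mono (by simp [Expr.cost]; omega) fun _ _ h => h
  intro m
  induction m with
  | zero =>
    intro j s' hj hA hij hI
    obtain rfl : j = B := by omega
    have hbs : s'.reg b = j := (hA.reg b hbF).trans hB
    exact ⟨_, _, .loop_done (by simp [Expr.eval, hij, hbs]), by simp [Expr.cost], hI⟩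
  | succ m ih =>
    intro j s' hj hA hij hI
    have hbs : s'.reg b = B := (hA.reg b hbF).trans hB
    obtain ⟨t, s₁, he, ht, hI₁⟩ := hstep j (by omega) s' hA hij hI
    have hs₁ : s₁.reg i = j := (he.agree.reg i hi).trans hij
    have hbody := Exec.seq he (.assign s₁ i (.add (.reg i) (.const 1)))
    have hev : Expr.eval s₁ (.add (.reg i) (.const 1)) = j + 1 := by simp [Expr.eval, hs₁]
    rw [hev] at hbody
    have hA' : Agree (RAM.forLoop i b P) s (s₁.setReg i (j + 1)) := by
      refine hA.trans ⟨fun y hy => hbody.agree.reg y ?_, fun a ha => hbody.agree.mem a ?_⟩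
      · simp only [RAM.forLoop, Program.writesReg, Bool.or_eq_false_iff] at hy ⊢
        exact hy.2
      · simp only [RAM.forLoop, Program.writesMem, Bool.or_eq_false_iff] at ha ⊢
        exact ha.2
    obtain ⟨t', s₂, he', ht', hI₂⟩ := ih (j + 1) _ (by omega) hA' (by simp) hI₁
    refine ⟨_, _, .loop_step (by simp [Expr.eval, hij, hbs]; omega) hbody he', ?_, hI₂⟩
    simp only [Expr.cost]
    have : (m + 1) * (T + 8) = m * (T + 8) + T + 8 := by ring
    omega

/-- A loop that raises the flag `r` if one of its rounds does. -/
theorem Run.any {i b r : ℕ} {P : Program} {s : State} {B T : ℕ} (φ : ℕ → Prop)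
    (hi : P.writesReg i = false) (hb : (i == b || P.writesReg b) = false) (hr : (r == i) = false)
    (hB : s.reg b = B)
    (hstep : ∀ j < B, ∀ s', Agree (RAM.forLoop i b P) s s' → s'.reg i = j →
      Run P s' T fun s'' => (s''.reg r ≠ 0 ↔ s'.reg r ≠ 0 ∨ φ j)) :
    Run (RAM.forLoop i b P) s (B * (T + 8) + 6)
      fun s' => (s'.reg r ≠ 0 ↔ s.reg r ≠ 0 ∨ ∃ j < B, φ j) := by
  rw [beq_eq_false_iff_ne] at hr
  refine Run.forLoop (fun j s' => (s'.reg r ≠ 0 ↔ s.reg r ≠ 0 ∨ ∃ j' < j, φ j')) hi hb hB ?_ ?_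
  · simp [hr]
  · intro j hj s' hA hij hI
    refine (hstep j hj s' hA hij).mono le_rfl fun s'' _ h => ?_
    rw [State.setReg_reg, if_neg hr, h, hI, or_assoc]
    simp only [Nat.lt_succ_iff_lt_or_eq, or_and_right, exists_or, exists_eq_left]

/-- The basic step of a search: raise the flag `r` if the condition `e` holds. -/
theorem Run.flag {e : Expr} {r : ℕ} {s : State} {φ : Prop} (h : e.eval s ≠ 0 ↔ φ) :
    Run (.ite e (.assign r (.const 1)) .skip) s (e.cost + 4)
      fun s' => (s'.reg r ≠ 0 ↔ s.reg r ≠ 0 ∨ φ) := by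
  refine (Run.straight (P := .ite e (.assign r (.const 1)) .skip) rfl
    (Q := fun s' => (s'.reg r ≠ 0 ↔ s.reg r ≠ 0 ∨ φ)) ?_).mono le_rfl fun _ _ h => h
  by_cases he : e.eval s = 0
  · simp [Program.denote, he, ← h]
  · simp [Program.denote, he, Expr.eval, ← h]

/-! ### Boolean expressions -/

namespace Expr

/-- Negation. -/
def notE (e : Expr) : Expr := .lt e (.const 1)

/-- Conjunction. -/
def andE (e₁ e₂ : Expr) : Expr := notE (.add (notE e₁) (notE e₂))

/-- Equality. -/
def eqE (e₁ e₂ : Expr) : Expr := notE (.add (.sub e₁ e₂) (.sub e₂ e₁))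

theorem eval_notE (s : State) (e : Expr) : (notE e).eval s = 0 ↔ e.eval s ≠ 0 := by
  simp [notE, eval]

theorem eval_add (s : State) (e₁ e₂ : Expr) :
    (Expr.add e₁ e₂).eval s = 0 ↔ e₁.eval s = 0 ∧ e₂.eval s = 0 := by
  simp [eval]

theorem eval_andE (s : State) (e₁ e₂ : Expr) :
    (andE e₁ e₂).eval s = 0 ↔ e₁.eval s = 0 ∨ e₂.eval s = 0 := by
  simp only [andE, eval_notE, eval_add, ne_eq]
  tauto

theorem eval_eqE (s : State) (e₁ e₂ : Expr) :
    (eqE e₁ e₂).eval s = 0 ↔ e₁.eval s ≠ e₂.eval s := by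
  simp only [eqE, eval_notE, eval]
  omega

theorem eval_lt (s : State) (e₁ e₂ : Expr) :
    (Expr.lt e₁ e₂).eval s = 0 ↔ e₂.eval s ≤ e₁.eval s := by
  simp [eval]

end Expr

open RAM.Program RAM.Expr

/-! ### Reading the input -/

/-- One letter of the input: registers `2`, `3`, `4` hold the value read so far, the weight of the
next bit and the number of values already stored in memory `1`. -/
def readLetter : Program :=
  .ite (.lt (.load 0 (.reg 1)) (.const 2))
    (.seq (.ite (.load 0 (.reg 1)) (.assign 2 (.add (.reg 2) (.reg 3))) .skip)
      (.assign 3 (.add (.reg 3) (.reg 3))))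
    (.seq (.store 1 (.reg 4) (.reg 2)) (.seq (.assign 4 (.add (.reg 4) (.const 1)))
      (.seq (.assign 2 (.const 0)) (.assign 3 (.const 1)))))

/-- Decode the input word into memory `1`. -/
def readInput : Program := .seq (.assign 3 (.const 1)) (forLoop 1 0 readLetter)

/-- The effect of one letter on the value read so far, the weight of the next bit and the list of
the values already read. -/
def scan (st : ℕ × ℕ × List ℕ) (c : Fin 3) : ℕ × ℕ × List ℕ :=
  if c.val < 2 then (if c.val = 0 then st.1 else st.1 + st.2.1, st.2.1 + st.2.1, st.2.2)
  else (0, 1, st.2.2 ++ [st.1])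

/-- Reading one bit doubles the weight, so the induction must allow any value `c` and weight `p` to
start from. The final weight is left unspecified because the separator resets it. -/
theorem foldl_scan_bits (a c p : ℕ) (out : List ℕ) :
    ∃ q, ((Nat.bits a).map (fun b => if b then (1 : Fin 3) else 0)).foldl scan (c, p, out) =
      (c + p * a, q, out) := by
  induction a using Nat.binaryRec' generalizing c p with
  | zero => exact ⟨p, by simp⟩
  | bit b n hn ih =>
    rw [Nat.bits_append_bit _ _ hn, List.map_cons, List.foldl_cons]
    cases b
    · obtain ⟨q, hq⟩ := ih c (p + p)
      refine ⟨q, ?_⟩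
      simp only [Bool.false_eq_true, if_false]
      rw [show scan (c, p, out) 0 = (c, p + p, out) from rfl, hq, Nat.bit_false]
      congr 1
      ring
    · obtain ⟨q, hq⟩ := ih (c + p) (p + p)
      refine ⟨q, ?_⟩
      simp only [if_true]
      rw [show scan (c, p, out) 1 = (c + p, p + p, out) from rfl, hq, Nat.bit_true]
      congr 1
      ring

theorem foldl_scan_encode (xs out : List ℕ) :
    (xs.flatMap fun a => (Nat.bits a).map (fun b => if b then (1 : Fin 3) else 0) ++ [2]).foldl scan
      (0, 1, out) = (0, 1, out ++ xs) := by
  induction xs generalizing out with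
  | nil => simp
  | cons a xs ih =>
    obtain ⟨q, hq⟩ := foldl_scan_bits a 0 1 out
    rw [List.flatMap_cons, List.foldl_append, List.foldl_append, hq]
    have : List.foldl scan (0 + 1 * a, q, out) [2] = (0, 1, out ++ [a]) := by
      simp [scan]
    rw [this, ih]
    simp

theorem run_readInput (w : List (Fin 3)) :
    Run readInput (inputState w) (w.length * (readLetter.time + 8) + 8) fun s =>
      ∀ i, s.mem 1 i = (w.foldl scan (0, 1, [])).2.2.getD i 0 := by
  refine (Run.seq (Run.assign (Run.forLoop (B := w.length) (T := readLetter.time)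
    (fun j s => s.reg 2 = ((w.take j).foldl scan (0, 1, [])).1 ∧
      s.reg 3 = ((w.take j).foldl scan (0, 1, [])).2.1 ∧
      s.reg 4 = ((w.take j).foldl scan (0, 1, [])).2.2.length ∧
      ∀ i, s.mem 1 i = ((w.take j).foldl scan (0, 1, [])).2.2.getD i 0)
    rfl rfl rfl ?_ ?_))).mono (by simp [Expr.cost]; omega) fun s _ h => ?_
  · simp [inputState, Expr.eval]
  · rintro j hj s hA hs ⟨h2, h3, h4, hm⟩
    refine Run.straight rfl ?_
    have h0 : s.mem 0 j = w[j].val := by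
      rw [hA.mem 0 rfl]
      simp [inputState, hj]
    rw [List.take_add_one, List.getElem?_eq_getElem hj, Option.toList_some, List.foldl_append,
      List.foldl_cons, List.foldl_nil]
    generalize (w.take j).foldl scan (0, 1, []) = st at h2 h3 h4 hm
    have hc : w[j].val < 3 := w[j].isLt
    generalize w[j] = c at h0 hc
    by_cases h : c.val < 2
    · by_cases h' : c.val = 0
      · simp [readLetter, Program.denote, Expr.eval, hs, h0, h', h2, h3, h4, hm, scan]
      · simp [readLetter, Program.denote, Expr.eval, hs, h0, h', h, h2, h3, h4, hm, scan]
    · simp only [readLetter, Program.denote, Expr.eval, hs, h0, h, h2, h3, h4, scan]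
      simp only [if_false, if_true, State.setReg_reg, State.setReg_mem, State.setMem_reg,
        State.setMem_mem, h2, h3, h4, hm]
      refine ⟨by simp, by simp, by simp, fun i => ?_⟩
      -- Cells below the new one are unchanged and cells above it are still `0`, which is the
      -- default value of `getD`.
      rcases lt_trichotomy i st.2.2.length with hi | hi | hi
      · simp [hi.ne, List.getElem?_append, hi]
      · simp [hi]
      · rw [if_neg (by omega), List.getD_eq_default _ _ hi.le,
          List.getD_eq_default _ _ (by simp; omega)]
  · have := h.2.2.2
    rwa [List.take_length] at this

/-! ### Preparations -/

/-- Read the header of the input and initialize the registers. -/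
def readHeader : Program :=
  .seq (.assign 5 (.load 1 (.const 0))) (.seq (.assign 6 (.load 1 (.const 1)))
    (.seq (.assign 7 (.load 1 (.const 2))) (.seq (.assign 9 (.const 3))
      (.seq (.assign 10 (.add (.reg 7) (.reg 6))) (.seq (.assign 11 (.const 1))
        (.assign 12 (.const 1)))))))

/-- Record the start of a row of the adjacency matrix. -/
def storeRow : Program :=
  .seq (.store 2 (.reg 8) (.reg 9)) (.assign 9 (.add (.reg 9) (.reg 5)))

/-- Compute row starts into memory `2`, the start of the colors into register `9`, and the numbers
`T = 2 ^ (k + ℓ)` and `T ^ k` into registers `11` and `12`. -/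
def prepare : Program :=
  .seq readHeader
    (.seq (forLoop 8 5 storeRow)
      (.seq (forLoop 13 10 (.assign 11 (.add (.reg 11) (.reg 11))))
        (forLoop 14 7 (forLoop 13 10 (.assign 12 (.add (.reg 12) (.reg 12)))))))

/-- What holds after the preparations, on an input given by the numbers `num`. -/
structure Prepared (num : ℕ → ℕ) (s : State) : Prop where
  numbers : s.mem 1 = num
  order : s.reg 5 = num 0
  colors : s.reg 6 = num 1
  target : s.reg 7 = num 2
  base : s.reg 9 = 3 + num 0 * num 0
  bound : s.reg 11 = 2 ^ (num 2 + num 1)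
  total : s.reg 12 = (2 ^ (num 2 + num 1)) ^ num 2
  row : ∀ u < num 0, s.mem 2 u = 3 + u * num 0

/-- Doubling by addition replaces the missing multiplication; powers of two are thus convenient as
bounds for the search. -/
theorem run_double {i b r : ℕ} (hi : (i == b) = false) (hr : (r == i) = false)
    (hb : (r == b) = false) (s : State) :
    Run (forLoop i b (.assign r (.add (.reg r) (.reg r)))) s (s.reg b * 12 + 6)
      fun s' => s'.reg r = s.reg r * 2 ^ s.reg b := by
  have hr' : (i == r) = false := by rwa [Bool.beq_comm]
  refine Run.forLoop (fun j s' => s'.reg r = s.reg r * 2 ^ j) (by simpa [Program.writesReg] using hr)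
    (by simp [Program.writesReg, hi, hb]) rfl ?_ ?_
  · simp at hr
    simp [hr]
  · intro j _ s' _ _ hI
    refine Run.straight (P := .assign r (.add (.reg r) (.reg r))) rfl ?_
    simp at hr
    simp [Program.denote, Expr.eval, hI, hr]
    ring

/-- Repeated addition tabulates the row starts, so that later a matrix entry is found without
multiplication. The offset 3 skips the header, and after the last row register `9` points to the
colors. -/
theorem run_storeRow (s : State) (h9 : s.reg 9 = 3) :
    Run (forLoop 8 5 storeRow) s (s.reg 5 * (storeRow.time + 8) + 6) fun s' =>
      s'.reg 9 = 3 + s.reg 5 * s.reg 5 ∧ ∀ u < s.reg 5, s'.mem 2 u = 3 + u * s.reg 5 := by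
  refine Run.forLoop (fun j s' => s'.reg 9 = 3 + j * s.reg 5 ∧
    ∀ u < j, s'.mem 2 u = 3 + u * s.reg 5) rfl rfl rfl (by simp [h9]) ?_
  rintro j - s' hA hj ⟨hI, hI'⟩
  refine Run.straight rfl ?_
  have h5 : s'.reg 5 = s.reg 5 := hA.reg 5 rfl
  simp only [storeRow, Program.denote, Expr.eval, State.setReg_reg, State.setReg_mem,
    State.setMem_reg, State.setMem_mem, hj, hI, h5]
  refine ⟨by simp; ring, fun u hu => ?_⟩
  by_cases huj : u = j
  · simp [huj]
  · simpa [huj] using hI' u (by omega)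

theorem run_prepare (s : State) (num : ℕ → ℕ) (hs : s.mem 1 = num) :
    Run prepare s (readHeader.time + (num 0 * (storeRow.time + 8) + 6 +
      ((num 2 + num 1) * 12 + 6 + (num 2 * ((num 2 + num 1) * 12 + 6 + 8) + 6))))
      (Prepared num) := by
  refine Run.seq_of (Run.straight rfl (Q := fun s' => s'.mem 1 = num ∧ s'.reg 5 = num 0 ∧
    s'.reg 6 = num 1 ∧ s'.reg 7 = num 2 ∧ s'.reg 9 = 3 ∧ s'.reg 10 = num 2 + num 1 ∧
    s'.reg 11 = 1 ∧ s'.reg 12 = 1) ?_) ?_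
  · simp [readHeader, Program.denote, Expr.eval, hs]
  rintro s₁ - ⟨h1, h5, h6, h7, h9, h10, h11, h12⟩
  have H₁ := run_storeRow s₁ h9
  rw [h5] at H₁
  refine Run.seq_of H₁ ?_
  rintro s₂ hA₂ ⟨h9, hrow⟩
  have H₂ := run_double (i := 13) (b := 10) (r := 11) rfl rfl rfl s₂
  rw [hA₂.reg 10 rfl, hA₂.reg 11 rfl, h10, h11, one_mul] at H₂
  refine Run.seq_of H₂ ?_
  rintro s₃ hA₃ h11
  -- Each outer round multiplies register `12` by `T`, as `k + ℓ` doublings.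
  have H₃ : Run (forLoop 14 7 (forLoop 13 10 (.assign 12 (.add (.reg 12) (.reg 12))))) s₃
      (num 2 * ((num 2 + num 1) * 12 + 6 + 8) + 6)
      fun s' => s'.reg 12 = (2 ^ (num 2 + num 1)) ^ num 2 := by
    refine Run.forLoop (fun j s' => s'.reg 12 = (2 ^ (num 2 + num 1)) ^ j) rfl rfl
      (by rw [hA₃.reg 7 rfl, hA₂.reg 7 rfl, h7])
      (by simp [hA₃.reg 12 rfl, hA₂.reg 12 rfl, h12]) ?_
    intro j _ s' hA _ hI
    have H := run_double (i := 13) (b := 10) (r := 12) rfl rfl rfl s'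
    rw [hA.reg 10 rfl, hA₃.reg 10 rfl, hA₂.reg 10 rfl, h10, hI] at H
    exact H.mono le_rfl fun s'' _ h => by simp [h, pow_succ]
  refine H₃.mono le_rfl fun s₄ hA₄ h12 => ?_
  constructor
  · rw [hA₄.mem 1 rfl, hA₃.mem 1 rfl, hA₂.mem 1 rfl, h1]
  · rw [hA₄.reg 5 rfl, hA₃.reg 5 rfl, hA₂.reg 5 rfl, h5]
  · rw [hA₄.reg 6 rfl, hA₃.reg 6 rfl, hA₂.reg 6 rfl, h6]
  · rw [hA₄.reg 7 rfl, hA₃.reg 7 rfl, hA₂.reg 7 rfl, h7]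
  · rw [hA₄.reg 9 rfl, hA₃.reg 9 rfl, h9]
  · rw [hA₄.reg 11 rfl, h11]
  · exact h12
  · rw [hA₄.mem 2 rfl, hA₃.mem 2 rfl]
    simpa [h5] using hrow

theorem Prepared.agree {num : ℕ → ℕ} {s s' : State} {P : Program} (h : Prepared num s)
    (hA : Agree P s s')
    (hr : ∀ y ∈ [5, 6, 7, 9, 11, 12], P.writesReg y = false)
    (hm : ∀ a ∈ [1, 2], P.writesMem a = false) : Prepared num s' where
  numbers := (hA.mem 1 (hm 1 (by simp))).trans h.numbers
  order := (hA.reg 5 (hr 5 (by simp))).trans h.order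
  colors := (hA.reg 6 (hr 6 (by simp))).trans h.colors
  target := (hA.reg 7 (hr 7 (by simp))).trans h.target
  base := (hA.reg 9 (hr 9 (by simp))).trans h.base
  bound := (hA.reg 11 (hr 11 (by simp))).trans h.bound
  total := (hA.reg 12 (hr 12 (by simp))).trans h.total
  row u hu := by rw [hA.mem 2 (hm 2 (by simp)), h.row u hu]

/-! ### The list of candidate pairs -/

/-- The vertex `u` lies in the closed neighborhood of the vertex `v`. -/
def InNbhd (num : ℕ → ℕ) (v u : ℕ) : Prop := u = v ∨ num (3 + v * num 0 + u) ≠ 0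

/-- The color of `u` plus one, or `0` if `u` is not precolored. -/
def colorAt (num : ℕ → ℕ) (u : ℕ) : ℕ := num (3 + num 0 * num 0 + u)

/-- Every precolored vertex in the closed neighborhood of `v` has the color `j`. -/
def Compat (num : ℕ → ℕ) (v j : ℕ) : Prop :=
  ∀ u < num 0, InNbhd num v u → colorAt num u ≠ 0 → colorAt num u = j + 1

/-- The list `L` enumerates the pairs of a vertex and a compatible color. -/
def IsPairs (num : ℕ → ℕ) (L : List (ℕ × ℕ)) : Prop :=
  L.Nodup ∧ ∀ p, p ∈ L ↔ p.1 < num 0 ∧ p.2 < num 1 ∧ Compat num p.1 p.2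

/-- The test for `InNbhd`. -/
def nbhdE (v u : Expr) : Expr := .add (eqE u v) (.load 1 (.add (.load 2 v) u))

/-- The expression for `colorAt`. -/
def colorE (u : Expr) : Expr := .load 1 (.add (.reg 9) u)

theorem Prepared.eval_nbhdE {num : ℕ → ℕ} {s : State} (h : Prepared num s) {v u : Expr}
    (hv : v.eval s < num 0) : (nbhdE v u).eval s ≠ 0 ↔ InNbhd num (v.eval s) (u.eval s) := by
  rw [nbhdE, Ne, eval_add, eval_eqE]
  simp only [Expr.eval, h.numbers, h.row _ hv, InNbhd]
  tauto

theorem Prepared.eval_colorE {num : ℕ → ℕ} {s : State} (h : Prepared num s) (u : Expr) :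
    (colorE u).eval s = colorAt num (u.eval s) := by
  simp [colorE, Expr.eval, h.numbers, h.base, colorAt]

/-- The vertex in register `18` shows that the vertex in register `16` is not compatible with the
color in register `17`. -/
def clashE : Expr :=
  andE (nbhdE (.reg 16) (.reg 18)) (andE (colorE (.reg 18))
    (notE (eqE (colorE (.reg 18)) (.add (.reg 17) (.const 1)))))

/-- Append the pair in registers `16` and `17` to the list. -/
def appendPair : Program :=
  .ite (notE (.reg 19)) (.seq (.store 3 (.reg 15) (.reg 16)) (.seq (.store 4 (.reg 15) (.reg 17))
    (.assign 15 (.add (.reg 15) (.const 1))))) .skip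

/-- Append the pair in registers `16` and `17` to the list if it is compatible. -/
def testPair : Program :=
  .seq (.assign 19 (.const 0)) (.seq
    (forLoop 18 5 (.ite clashE (.assign 19 (.const 1)) .skip)) appendPair)

/-- List the compatible pairs in memories `3` and `4`, and their number in register `15`. -/
def listPairs : Program :=
  .seq (.assign 15 (.const 0)) (forLoop 16 5 (forLoop 17 6 testPair))

/-- Register `15` and memories `3` and `4` hold the list `L`. -/
def Holds (L : List (ℕ × ℕ)) (s : State) : Prop :=
  s.reg 15 = L.length ∧ ∀ i < L.length, s.mem 3 i = (L.getD i (0, 0)).1 ∧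
    s.mem 4 i = (L.getD i (0, 0)).2

/-- The list `L` enumerates the compatible pairs that precede `(v, j)` lexicographically. -/
def IsPairsBefore (num : ℕ → ℕ) (v j : ℕ) (L : List (ℕ × ℕ)) : Prop :=
  L.Nodup ∧ ∀ p, p ∈ L ↔ (p.1 < v ∨ p.1 = v ∧ p.2 < j) ∧ p.1 < num 0 ∧ p.2 < num 1 ∧
    Compat num p.1 p.2

theorem IsPairsBefore.succ_row {num : ℕ → ℕ} {v : ℕ} {L : List (ℕ × ℕ)}
    (h : IsPairsBefore num v (num 1) L) : IsPairsBefore num (v + 1) 0 L := by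
  refine ⟨h.1, fun p => (h.2 p).trans ?_⟩
  constructor
  · rintro ⟨h, h'⟩
    exact ⟨by omega, h'⟩
  · rintro ⟨h, h', h'', h'''⟩
    exact ⟨by omega, h', h'', h'''⟩

theorem run_testPair {num : ℕ → ℕ} {s : State} (h : Prepared num s) {v j : ℕ} {L : List (ℕ × ℕ)}
    (hv : s.reg 16 = v) (hj : s.reg 17 = j) (hvn : v < num 0) (hjl : j < num 1) (hL : Holds L s)
    (hP : IsPairsBefore num v j L) :
    Run testPair s (2 + (num 0 * (clashE.cost + 4 + 8) + 6 + appendPair.time)) fun s' =>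
      ∃ L', Holds L' s' ∧ IsPairsBefore num v (j + 1) L' := by
  refine Run.seq_of (Run.straight rfl (Q := fun s' => s'.reg 19 = 0)
    (by simp [Program.denote, Expr.eval])) fun s₁ hA₁ h19 => ?_
  have h₁ : Prepared num s₁ := h.agree hA₁ (by decide) (by decide)
  refine Run.seq_of (Run.any (r := 19) (fun u => InNbhd num v u ∧ colorAt num u ≠ 0 ∧
    colorAt num u ≠ j + 1) rfl rfl rfl h₁.order fun u _ s' hA hu => Run.flag ?_) ?_
  · have h' : Prepared num s' := h₁.agree hA (by decide) (by decide)
    have h16 : s'.reg 16 = v := by rw [hA.reg 16 rfl, hA₁.reg 16 rfl, hv]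
    have h17 : s'.reg 17 = j := by rw [hA.reg 17 rfl, hA₁.reg 17 rfl, hj]
    rw [clashE, Ne, eval_andE, eval_andE, eval_notE, Ne, eval_eqE, not_or, not_or, ← Ne,
      h'.eval_nbhdE (by simpa [Expr.eval, h16] using hvn), h'.eval_colorE]
    simp [Expr.eval, h16, h17, hu]
  · intro s₂ hA₂ h19'
    have h16 : s₂.reg 16 = v := by rw [hA₂.reg 16 rfl, hA₁.reg 16 rfl, hv]
    have h17 : s₂.reg 17 = j := by rw [hA₂.reg 17 rfl, hA₁.reg 17 rfl, hj]
    have h15 : s₂.reg 15 = L.length := by rw [hA₂.reg 15 rfl, hA₁.reg 15 rfl, hL.1]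
    have hm : ∀ i < L.length, s₂.mem 3 i = (L.getD i (0, 0)).1 ∧
        s₂.mem 4 i = (L.getD i (0, 0)).2 := by
      intro i hi
      rw [hA₂.mem 3 rfl, hA₁.mem 3 rfl, hA₂.mem 4 rfl, hA₁.mem 4 rfl]
      exact hL.2 i hi
    -- The flag stays down exactly when no vertex of the closed neighborhood has a color other than
    -- `j`.
    have hC : s₂.reg 19 = 0 ↔ Compat num v j := by
      rw [← not_iff_not, ← Ne, h19', h19, Compat]
      push Not
      simp only [ne_eq, not_true_eq_false, false_or]
    refine Run.straight rfl ?_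
    by_cases hc : s₂.reg 19 = 0
    · refine ⟨L ++ [(v, j)], ?_, ?_, ?_⟩
      · have hev : (notE (Expr.reg 19)).eval s₂ ≠ 0 := by
          rw [Ne, eval_notE]
          simpa [Expr.eval] using hc
        simp only [appendPair, Program.denote, if_neg hev, Holds]
        refine ⟨by simp [Expr.eval, h15], fun i hi => ?_⟩
        rcases Nat.lt_succ_iff_lt_or_eq.mp (by simpa using hi) with hi' | rfl
        · simp [Expr.eval, h15, hi'.ne, hm i hi', List.getElem?_append, hi']
        · simp [Expr.eval, h15, h16, h17]
      -- The pair `(v, j)` is new because the list so far contains only pairs strictly before it.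
      · rw [List.nodup_append]
        refine ⟨hP.1, by simp, ?_⟩
        rintro p hp q hq rfl
        obtain rfl : p = (v, j) := by simpa using hq
        have := ((hP.2 _).1 hp).1
        simp at this
      · rintro ⟨p, q⟩
        simp only [List.mem_append, hP.2, List.mem_singleton, Prod.mk.injEq]
        constructor
        · rintro (⟨h, h'⟩ | ⟨rfl, rfl⟩)
          · exact ⟨by omega, h'⟩
          · exact ⟨by omega, hvn, hjl, hC.1 hc⟩
        · rintro ⟨h, h'⟩
          by_cases hpq : p = v ∧ q = j
          · exact .inr hpq
          · exact .inl ⟨by omega, h'⟩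
    · have hev : (notE (Expr.reg 19)).eval s₂ = 0 := by
        rw [eval_notE]
        simpa [Expr.eval] using hc
      simp only [appendPair, Program.denote, if_pos hev]
      refine ⟨L, ⟨h15, hm⟩, hP.1, ?_⟩
      rintro ⟨p, q⟩
      refine (hP.2 _).trans ?_
      constructor
      · rintro ⟨h, h'⟩
        exact ⟨by dsimp only at h ⊢; omega, h'⟩
      · rintro ⟨h, h₁, h₂, h₃⟩
        refine ⟨?_, h₁, h₂, h₃⟩
        by_cases hpq : p = v ∧ q = j
        · obtain ⟨rfl, rfl⟩ := hpq
          exact absurd h₃ fun h => hc (hC.2 h)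
        · dsimp only at h ⊢; omega

theorem run_listPairs {num : ℕ → ℕ} {s : State} (h : Prepared num s) :
    Run listPairs s (2 + (num 0 * (num 1 * (2 + (num 0 * (clashE.cost + 4 + 8) + 6 +
      appendPair.time) + 8) + 6 + 8) + 6)) fun s' => ∃ L, Holds L s' ∧ IsPairs num L := by
  refine Run.seq_of (Run.straight rfl (Q := fun s' => s'.reg 15 = 0)
    (by simp [Program.denote, Expr.eval])) fun s₁ hA₁ h15 => ?_
  have h₁ : Prepared num s₁ := h.agree hA₁ (by decide) (by decide)
  refine (Run.forLoop (fun v s' => ∃ L, Holds L s' ∧ IsPairsBefore num v 0 L) rfl rfl h₁.order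
    ⟨[], by simp [Holds, h15], by simp [IsPairsBefore]⟩ ?_).mono le_rfl ?_
  · rintro v hv s₂ hA₂ h16 ⟨L, hL, hP⟩
    have h₂ : Prepared num s₂ := h₁.agree hA₂ (by decide) (by decide)
    refine (Run.forLoop (fun j s' => ∃ L, Holds L s' ∧ IsPairsBefore num v j L) rfl rfl h₂.colors
      ⟨L, by simpa [Holds] using hL, hP⟩ ?_).mono le_rfl ?_
    · rintro j hj s₃ hA₃ h17 ⟨L, hL, hP⟩
      have h₃ : Prepared num s₃ := h₂.agree hA₃ (by decide) (by decide)
      refine (run_testPair h₃ ((hA₃.reg 16 rfl).trans h16) h17 hv hj hL hP).mono le_rfl ?_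
      rintro s₄ - ⟨L, hL, hP⟩
      exact ⟨L, by simpa [Holds] using hL, hP⟩
    · rintro s₄ - ⟨L, hL, hP⟩
      exact ⟨L, by simpa [Holds] using hL, hP.succ_row⟩
  · rintro s' - ⟨L, hL, hP⟩
    refine ⟨L, hL, hP.1, fun p => (hP.2 p).trans ?_⟩
    simp only [Nat.not_lt_zero, and_false, or_false, and_iff_right_iff_imp]
    exact fun h => h.1

/-! ### The search for compatible assignments -/

/-- One step of division with remainder by repeated subtraction. -/
def divStep : Program :=
  .ite (notE (.lt (.reg 29) (.reg 11)))
    (.seq (.assign 29 (.sub (.reg 29) (.reg 11))) (.assign 22 (.add (.reg 22) (.const 1)))) .skip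

/-- Divide register `21` by register `11`; the quotient goes to register `22`, the remainder to
register `29`. -/
def divide : Program :=
  .seq (.seq (.assign 29 (.reg 21)) (.assign 22 (.const 0))) (forLoop 30 21 divStep)

/-- The loop makes `y` rounds, at least as many as the subtractions needed; surplus rounds do
nothing. The bound is in terms of any `x ≥ y`, so that all digits of one number can share it. -/
theorem run_divide {s : State} {y T x : ℕ} (hy : s.reg 21 = y) (hT : s.reg 11 = T) (hT0 : 0 < T)
    (hyx : y ≤ x) :
    Run divide s (4 + (x * (divStep.time + 8) + 6)) fun s' =>
      s'.reg 22 = y / T ∧ s'.reg 29 = y % T := by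
  refine (Run.seq_of (Run.straight rfl (Q := fun s' => s'.reg 29 = y ∧ s'.reg 22 = 0)
    (by simp [Program.denote, Expr.eval, hy])) ?_).mono (T := 4 + (y * (divStep.time + 8) + 6))
    (by gcongr) fun _ _ h => h
  rintro s₁ hA₁ ⟨h29, h22⟩
  refine (Run.forLoop (fun j s' => s'.reg 29 + T * s'.reg 22 = y ∧
    (s'.reg 29 < T ∨ j ≤ s'.reg 22)) rfl rfl ((hA₁.reg 21 rfl).trans hy) (by simp [h29, h22])
    ?_).mono le_rfl ?_
  · rintro j hj s' hA - ⟨h, h'⟩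
    have h11 : s'.reg 11 = T := by rw [hA.reg 11 rfl, hA₁.reg 11 rfl, hT]
    refine Run.straight rfl ?_
    by_cases hc : s'.reg 29 < T
    · simp [divStep, Program.denote, Expr.eval, notE, h11, hc, h]
    · have hc' : T ≤ s'.reg 29 := not_lt.mp hc
      have h'' : j ≤ s'.reg 22 := h'.resolve_left hc
      simp only [divStep, Program.denote, Expr.eval, notE, h11, hc, State.setReg_reg]
      suffices s'.reg 29 - T + T * (s'.reg 22 + 1) = y ∧
          (s'.reg 29 - T < T ∨ j + 1 ≤ s'.reg 22 + 1) by simpa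
      refine ⟨?_, .inr (by omega)⟩
      rw [mul_add]
      omega
  · rintro s' - ⟨h, h'⟩
    have hlt : s'.reg 29 < T := by
      -- If the remainder were still at least `T`, every round would have subtracted, so `T` times
      -- the quotient would be at least `y`, leaving no room for a positive remainder.
      by_contra hc
      have : s'.reg 22 ≤ T * s'.reg 22 := Nat.le_mul_of_pos_left _ hT0
      have := h'.resolve_left hc
      omega
    rw [← h]
    constructor
    · rw [Nat.add_mul_div_left _ _ hT0, Nat.div_eq_of_lt hlt, zero_add]
    · rw [Nat.add_mul_mod_self_left, Nat.mod_eq_of_lt hlt]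

/-- Store the digits of register `20` in base `T` in memory `5`. -/
def extractDigits : Program :=
  .seq (.assign 21 (.reg 20)) (forLoop 23 7 (.seq divide
    (.seq (.store 5 (.reg 23) (.reg 29)) (.assign 21 (.reg 22)))))

theorem run_extractDigits {s : State} {x T k : ℕ} (hx : s.reg 20 = x) (hT : s.reg 11 = T)
    (hT0 : 0 < T) (hk : s.reg 7 = k) :
    Run extractDigits s (2 + (k * ((4 + (x * (divStep.time + 8) + 6) + 5) + 8) + 6)) fun s' =>
      ∀ a < k, s'.mem 5 a = x / T ^ a % T := by
  refine Run.seq_of (Run.straight rfl (Q := fun s' => s'.reg 21 = x)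
    (by simp [Program.denote, Expr.eval, hx])) fun s₁ hA₁ h21 => ?_
  refine (Run.forLoop (fun j s' => s'.reg 21 = x / T ^ j ∧
    ∀ a < j, s'.mem 5 a = x / T ^ a % T) rfl rfl ((hA₁.reg 7 rfl).trans hk) (by simp [h21])
    ?_).mono le_rfl fun s' _ h => h.2
  rintro j hj s₂ hA₂ h23 ⟨h21, h5⟩
  have h11 : s₂.reg 11 = T := by rw [hA₂.reg 11 rfl, hA₁.reg 11 rfl, hT]
  refine Run.seq_of (run_divide h21 h11 hT0 (Nat.div_le_self _ _)) ?_
  rintro s₃ hA₃ ⟨h22, h29⟩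
  refine Run.straight (P := .seq (.store 5 (.reg 23) (.reg 29)) (.assign 21 (.reg 22))) rfl ?_
  simp only [Program.denote, Expr.eval, State.setReg_reg, State.setReg_mem, State.setMem_reg,
    State.setMem_mem, hA₃.reg 23 rfl, h23, h22, h29]
  refine ⟨by simp [Nat.div_div_eq_div_mul, pow_succ], fun a ha => ?_⟩
  by_cases haj : a = j
  · simp [haj]
  · simpa [haj, hA₃.mem 5 rfl] using h5 a (by omega)

/-- The indices `a` and `b` are assigned the same vertex, or vertices with a common closed
neighbor `u` and different colors. -/
def Conflict (num : ℕ → ℕ) (L : List (ℕ × ℕ)) (g : ℕ → ℕ) (a b u : ℕ) : Prop :=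
  a ≠ b ∧ InNbhd num (L.getD (g a) (0, 0)).1 u ∧ InNbhd num (L.getD (g b) (0, 0)).1 u ∧
    ((L.getD (g a) (0, 0)).1 = (L.getD (g b) (0, 0)).1 ∨
      (L.getD (g a) (0, 0)).2 ≠ (L.getD (g b) (0, 0)).2)

/-- The digits `g` do not describe a choice of `k` distinct vertices that can be happy
simultaneously. -/
def Bad (num : ℕ → ℕ) (L : List (ℕ × ℕ)) (g : ℕ → ℕ) : Prop :=
  (∃ a < num 2, L.length ≤ g a) ∨ ∃ a < num 2, ∃ b < num 2, ∃ u < num 0,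
    g a < L.length ∧ g b < L.length ∧ Conflict num L g a b u

/-- The vertex chosen by the index in register `r`. -/
def vertexE (r : ℕ) : Expr := .load 3 (.load 5 (.reg r))

/-- The color chosen by the index in register `r`. -/
def chosenE (r : ℕ) : Expr := .load 4 (.load 5 (.reg r))

/-- The index in register `r` points into the list. -/
def validE (r : ℕ) : Expr := .lt (.load 5 (.reg r)) (.reg 15)

/-- The test for a conflict between the choices in registers `24` and `25` at the vertex in
register `26`. -/
def conflictE : Expr :=
  andE (validE 24) (andE (validE 25) (andE (notE (eqE (.reg 24) (.reg 25)))
    (andE (nbhdE (vertexE 24) (.reg 26)) (andE (nbhdE (vertexE 25) (.reg 26))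
      (.add (eqE (vertexE 24) (vertexE 25)) (notE (eqE (chosenE 24) (chosenE 25))))))))

/-- Raise the flag in register `27` if the digits in memory `5` are bad. -/
def testDigits : Program :=
  .seq (.assign 27 (.const 0)) (.seq
    (forLoop 24 7 (.ite (notE (validE 24)) (.assign 27 (.const 1)) .skip))
    (forLoop 24 7 (forLoop 25 7 (forLoop 26 5 (.ite conflictE (.assign 27 (.const 1)) .skip)))))

theorem eval_conflictE {num : ℕ → ℕ} {L : List (ℕ × ℕ)} {g : ℕ → ℕ} {s : State} {a b u : ℕ}
    (h : Prepared num s) (hL : Holds L s) (hP : IsPairs num L) (hg : ∀ a < num 2, s.mem 5 a = g a)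
    (ha : s.reg 24 = a) (hb : s.reg 25 = b) (hu : s.reg 26 = u) (hak : a < num 2)
    (hbk : b < num 2) :
    conflictE.eval s ≠ 0 ↔ g a < L.length ∧ g b < L.length ∧ Conflict num L g a b u := by
  have hga := hg a hak
  have hgb := hg b hbk
  have hva : (validE 24).eval s ≠ 0 ↔ g a < L.length := by
    simp [validE, Expr.eval, ha, hL.1, hga]
  have hvb : (validE 25).eval s ≠ 0 ↔ g b < L.length := by
    simp [validE, Expr.eval, hb, hL.1, hgb]
  simp only [conflictE, Ne, eval_andE, eval_notE, eval_eqE, eval_add, not_or, not_and_or, not_not]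
  rw [← Ne, hva, ← Ne, hvb]
  -- Only for positions inside the list does memory `3` hold actual vertices, for which row starts
  -- are tabulated; the neighborhood tests are therefore evaluated under both range conditions.
  refine and_congr_right fun hla => and_congr_right fun hlb => ?_
  have h3a := hL.2 _ hla
  have h3b := hL.2 _ hlb
  have hna : s.mem 3 (g a) < num 0 := by
    rw [h3a.1, List.getD_eq_getElem _ _ hla]
    exact ((hP.2 _).1 (List.getElem_mem hla)).1
  have hnb : s.mem 3 (g b) < num 0 := by
    rw [h3b.1, List.getD_eq_getElem _ _ hlb]
    exact ((hP.2 _).1 (List.getElem_mem hlb)).1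
  have hNa := h.eval_nbhdE (v := vertexE 24) (u := .reg 26)
    (by simpa [vertexE, Expr.eval, ha, hga] using hna)
  have hNb := h.eval_nbhdE (v := vertexE 25) (u := .reg 26)
    (by simpa [vertexE, Expr.eval, hb, hgb] using hnb)
  rw [Ne] at hNa hNb
  rw [hNa, hNb]
  simp only [vertexE, chosenE, Expr.eval, ha, hb, hu, hga, hgb, h3a.1, h3a.2, h3b.1, h3b.2,
    Conflict, ne_eq]

theorem run_testDigits {num : ℕ → ℕ} {L : List (ℕ × ℕ)} {g : ℕ → ℕ} {s : State}
    (h : Prepared num s) (hL : Holds L s) (hP : IsPairs num L)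
    (hg : ∀ a < num 2, s.mem 5 a = g a) :
    Run testDigits s (2 + (num 2 * ((notE (validE 24)).cost + 4 + 8) + 6 +
      (num 2 * (num 2 * (num 0 * (conflictE.cost + 4 + 8) + 6 + 8) + 6 + 8) + 6)))
      fun s' => (s'.reg 27 ≠ 0 ↔ Bad num L g) := by
  refine Run.seq_of (Run.straight rfl (Q := fun s' => s'.reg 27 = 0)
    (by simp [Program.denote, Expr.eval])) fun s₁ hA₁ h27 => ?_
  have h₁ : Prepared num s₁ := h.agree hA₁ (by decide) (by decide)
  refine Run.seq_of (Run.any (r := 27) (fun a => L.length ≤ g a) rfl rfl rfl h₁.target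
    fun a ha s' hA h24 => Run.flag ?_) fun s₂ hA₂ h27' => ?_
  · rw [Ne, eval_notE, validE, Ne, not_not, eval_lt]
    simp [Expr.eval, h24, hA.mem 5 rfl, hA₁.mem 5 rfl, hg a ha, hA.reg 15 rfl, hA₁.reg 15 rfl, hL.1]
  have h₂ : Prepared num s₂ := h₁.agree hA₂ (by decide) (by decide)
  refine (Run.any (r := 27) (fun a => ∃ b < num 2, ∃ u < num 0,
    g a < L.length ∧ g b < L.length ∧ Conflict num L g a b u) rfl rfl rfl h₂.target
    fun a ha s₃ hA₃ h24 => ?_).mono le_rfl fun s' _ hs => ?_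
  · have h₃ : Prepared num s₃ := h₂.agree hA₃ (by decide) (by decide)
    refine Run.any (r := 27) _ rfl rfl rfl h₃.target fun b hb s₄ hA₄ h25 => ?_
    have h₄ : Prepared num s₄ := h₃.agree hA₄ (by decide) (by decide)
    refine Run.any (r := 27) _ rfl rfl rfl h₄.order fun u hu s₅ hA₅ h26 => Run.flag ?_
    refine eval_conflictE (h₄.agree hA₅ (by decide) (by decide)) ?_ hP ?_ ?_ ?_ h26 ha hb
    · rw [Holds, hA₅.reg 15 rfl, hA₄.reg 15 rfl, hA₃.reg 15 rfl, hA₂.reg 15 rfl, hA₁.reg 15 rfl,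
        hA₅.mem 3 rfl, hA₄.mem 3 rfl, hA₃.mem 3 rfl, hA₂.mem 3 rfl, hA₁.mem 3 rfl,
        hA₅.mem 4 rfl, hA₄.mem 4 rfl, hA₃.mem 4 rfl, hA₂.mem 4 rfl, hA₁.mem 4 rfl]
      exact hL
    · rw [hA₅.mem 5 rfl, hA₄.mem 5 rfl, hA₃.mem 5 rfl, hA₂.mem 5 rfl, hA₁.mem 5 rfl]
      exact hg
    · rw [hA₅.reg 24 rfl, hA₄.reg 24 rfl, h24]
    · rw [hA₅.reg 25 rfl, h25]
  · rw [hs, h27', h27, Bad]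
    simp

/-- Try the assignment described by register `20`, and raise the flag in register `28` if it is
not bad. -/
def searchRound : Program :=
  .seq extractDigits (.seq testDigits (.ite (notE (.reg 27)) (.assign 28 (.const 1)) .skip))

/-- Decide the instance once the compatible pairs are listed. -/
def search : Program :=
  .seq (.assign 28 (.const 0)) (.seq (.ite (notE (.lt (.reg 15) (.reg 11)))
    (.assign 28 (.const 1)) (forLoop 20 12 searchRound)) (.assign 0 (.reg 28)))

/-- The outcome of the search. -/
def Accepts (num : ℕ → ℕ) (L : List (ℕ × ℕ)) : Prop :=
  2 ^ (num 2 + num 1) ≤ L.length ∨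
    ∃ x < (2 ^ (num 2 + num 1)) ^ num 2,
      ¬ Bad num L fun a => x / (2 ^ (num 2 + num 1)) ^ a % 2 ^ (num 2 + num 1)

/-- A bound on the time of a round of the search. -/
def roundTime (n k X : ℕ) : ℕ :=
  2 + (k * ((4 + (X * (divStep.time + 8) + 6) + 5) + 8) + 6) +
    (2 + (k * ((notE (validE 24)).cost + 4 + 8) + 6 +
      (k * (k * (n * (conflictE.cost + 4 + 8) + 6 + 8) + 6 + 8) + 6)) +
      ((notE (.reg 27)).cost + 4))

theorem run_searchRound {num : ℕ → ℕ} {L : List (ℕ × ℕ)} {s : State} {x X : ℕ}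
    (h : Prepared num s) (hL : Holds L s) (hP : IsPairs num L) (hx : s.reg 20 = x) (hxX : x ≤ X) :
    Run searchRound s (roundTime (num 0) (num 2) X) fun s' => (s'.reg 28 ≠ 0 ↔ s.reg 28 ≠ 0 ∨
      ¬ Bad num L fun a => x / (2 ^ (num 2 + num 1)) ^ a % 2 ^ (num 2 + num 1)) := by
  refine Run.seq_of ((run_extractDigits hx h.bound (by positivity) h.target).mono (by gcongr)
    fun _ _ h => h) fun s₁ hA₁ h₁ => ?_
  refine Run.seq_of (run_testDigits (h.agree hA₁ (by decide) (by decide)) ?_ hP h₁)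
    fun s₂ hA₂ h₂ => ?_
  · rw [Holds, hA₁.reg 15 rfl, hA₁.mem 3 rfl, hA₁.mem 4 rfl]
    exact hL
  · rw [← hA₁.reg 28 rfl, ← hA₂.reg 28 rfl]
    refine Run.flag ?_
    rw [Ne, eval_notE, ← h₂]
    rfl

theorem run_search {num : ℕ → ℕ} {L : List (ℕ × ℕ)} {s : State}
    (h : Prepared num s) (hL : Holds L s) (hP : IsPairs num L) :
    Run search s (2 + ((notE (.lt (.reg 15) (.reg 11))).cost + 1 +
      ((2 ^ (num 2 + num 1)) ^ num 2 *
        (roundTime (num 0) (num 2) ((2 ^ (num 2 + num 1)) ^ num 2) + 8) + 6) + 2))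
      fun s' => (s'.reg 0 ≠ 0 ↔ Accepts num L) := by
  refine Run.seq_of (Run.straight rfl (Q := fun s' => s'.reg 28 = 0)
    (by simp [Program.denote, Expr.eval])) fun s₁ hA₁ h28 => ?_
  have h₁ : Prepared num s₁ := h.agree hA₁ (by decide) (by decide)
  have hL₁ : Holds L s₁ := by
    rw [Holds, hA₁.reg 15 rfl, hA₁.mem 3 rfl, hA₁.mem 4 rfl]
    exact hL
  have hev : (notE (Expr.lt (.reg 15) (.reg 11))).eval s₁ ≠ 0 ↔
      2 ^ (num 2 + num 1) ≤ L.length := by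
    rw [Ne, eval_notE, Ne, not_not, eval_lt]
    simp [Expr.eval, h₁.bound, hL₁.1]
  refine Run.seq_of (Q' := fun s' => s'.reg 28 ≠ 0 ↔ Accepts num L) (Run.ite (fun he => ?_)
    fun he => ?_) fun s₂ _ h₂ => ?_
  · refine (Run.straight (P := .assign 28 (.const 1)) rfl
      (Q := fun s' => s'.reg 28 ≠ 0 ↔ Accepts num L) ?_).mono ?_ fun _ _ h => h
    · simpa [Program.denote, Expr.eval, Accepts] using .inl (hev.1 he)
    · simp [Program.time, Expr.cost]
  · refine (Run.any (r := 28) _ rfl rfl rfl h₁.total fun x hx s' hA hs => run_searchRound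
      (h₁.agree hA (by decide) (by decide)) ?_ hP hs hx.le).mono le_rfl fun s' _ h => ?_
    · rw [Holds, hA.reg 15 rfl, hA.mem 3 rfl, hA.mem 4 rfl]
      exact hL₁
    · have : ¬ 2 ^ (num 2 + num 1) ≤ L.length := fun h => hev.2 h he
      rw [h, Accepts, h28]
      simp [this]
  · exact Run.assign (by simpa [Expr.eval] using h₂)

/-- The decision procedure. -/
def decideProgram : Program := .seq readInput (.seq prepare (.seq listPairs search))

/-- A bound on the time of the decision procedure. -/
def totalTime (len n ℓ k : ℕ) : ℕ :=
  len * (readLetter.time + 8) + 8 +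
  (readHeader.time + (n * (storeRow.time + 8) + 6 + ((k + ℓ) * 12 + 6 +
    (k * ((k + ℓ) * 12 + 6 + 8) + 6))) +
  (2 + (n * (ℓ * (2 + (n * (clashE.cost + 4 + 8) + 6 + appendPair.time) + 8) + 6 + 8) + 6) +
  (2 + ((notE (.lt (.reg 15) (.reg 11))).cost + 1 + ((2 ^ (k + ℓ)) ^ k *
    (roundTime n k ((2 ^ (k + ℓ)) ^ k) + 8) + 6) + 2))))

/-- The list is existentially quantified: correctness uses only that it satisfies `IsPairs`, not its
order. -/
theorem run_decideProgram (xs : List ℕ) (num : ℕ → ℕ) (hnum : num = fun i => xs.getD i 0)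
    (w : List (Fin 3)) (hw : w = xs.flatMap fun a =>
      (Nat.bits a).map (fun b => if b then (1 : Fin 3) else 0) ++ [2]) :
    Run decideProgram (inputState w) (totalTime w.length (num 0) (num 1) (num 2)) fun s =>
      ∃ L, IsPairs num L ∧ (s.reg 0 ≠ 0 ↔ Accepts num L) := by
  refine Run.seq_of (run_readInput w) fun s₁ _ h₁ => ?_
  have hm : s₁.mem 1 = num := by
    funext i
    rw [h₁, hw, foldl_scan_encode, hnum, List.nil_append]
  refine Run.seq_of (run_prepare s₁ num hm) fun s₂ _ h₂ => ?_
  refine Run.seq_of (run_listPairs h₂) ?_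
  rintro s₃ hA₃ ⟨L, hL, hP⟩
  exact (run_search (h₂.agree hA₃ (by decide) (by decide)) hL hP).mono le_rfl
    fun s _ h => ⟨L, hP, h⟩

end RAM

/-! ### Positions in a matrix stored row by row, and numbers with prescribed digits -/

theorem List.getElem?_flatMap_of_length_eq {α β : Type*} {n : ℕ} (f : α → List β)
    (hf : ∀ a, (f a).length = n) (l : List α) (u : ℕ) {v : ℕ} (hv : v < n) :
    (l.flatMap f)[u * n + v]? = l[u]?.bind fun a => (f a)[v]? := by
  induction l generalizing u with
  | nil => simp
  | cons a l ih =>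
    rw [List.flatMap_cons]
    cases u with
    | zero => simp [List.getElem?_append, hf, hv]
    | succ u =>
      rw [List.getElem?_append_right (by rw [hf]; nlinarith), hf, List.getElem?_cons_succ, ← ih]
      congr 1
      have : (u + 1) * n = u * n + n := by ring
      omega

theorem Nat.exists_lt_pow_digits {T k : ℕ} (g : ℕ → ℕ) (hg : ∀ a < k, g a < T) :
    ∃ x < T ^ k, ∀ a < k, x / T ^ a % T = g a := by
  refine ⟨finFunctionFinEquiv fun a : Fin k => ⟨g a, hg a a.isLt⟩, Fin.isLt _, fun a ha => ?_⟩
  have := congrFun (finFunctionFinEquiv.symm_apply_apply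
    fun a : Fin k => (⟨g a, hg a a.isLt⟩ : Fin T)) ⟨a, ha⟩
  exact congrArg Fin.val this

namespace MaxHappyVertices

open RAM

/-! ### The numbers of an instance -/

/-- The numbers of an instance as a function on the indices. -/
noncomputable def num (I : MaxHappyVertices) (i : ℕ) : ℕ := I.numbers.getD i 0

theorem num_zero (I : MaxHappyVertices) : I.num 0 = I.n := by simp [num, numbers]

theorem num_one (I : MaxHappyVertices) : I.num 1 = I.ℓ := by simp [num, numbers]

theorem num_two (I : MaxHappyVertices) : I.num 2 = I.k := by simp [num, numbers]

theorem length_rows (I : MaxHappyVertices) (f : Fin I.n → Fin I.n → ℕ) :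
    ((List.finRange I.n).flatMap fun u => (List.finRange I.n).map fun v => f u v).length =
      I.n * I.n := by
  simp [List.length_flatMap]

theorem length_numbers (I : MaxHappyVertices) : I.numbers.length = 3 + I.n * I.n + I.n := by
  simp [numbers, List.length_flatMap]
  ring

open Classical in
theorem num_row (I : MaxHappyVertices) (u v : Fin I.n) :
    I.num (3 + u * I.num 0 + v) = if I.G.Adj u v then 1 else 0 := by
  have hlt : (u : ℕ) * I.n + v < I.n * I.n := by
    have := u.isLt
    have := v.isLt
    nlinarith
  rw [num_zero, num, numbers, List.getD_eq_getElem?_getD, List.append_assoc,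
    List.getElem?_append_right (by simp only [List.length_cons, List.length_nil]; omega), List.getElem?_append_left (by
      rw [length_rows]; simp only [List.length_cons, List.length_nil]; omega)]
  rw [show 3 + (u : ℕ) * I.n + v - [I.n, I.ℓ, I.k].length =
    u * I.n + v by simp only [List.length_cons, List.length_nil]; omega,
    List.getElem?_flatMap_of_length_eq _ (by simp) _ _ v.isLt]
  simp

theorem colorAt_num (I : MaxHappyVertices) (u : Fin I.n) :
    colorAt I.num u = (I.p u).elim 0 fun j => (j : ℕ) + 1 := by
  rw [colorAt, num_zero, num, numbers, List.getD_eq_getElem?_getD, List.getElem?_append_right (by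
      rw [List.length_append, length_rows]; simp only [List.length_cons, List.length_nil]; omega)]
  rw [List.length_append, length_rows]
  rw [show 3 + I.n * I.n + (u : ℕ) - ([I.n, I.ℓ, I.k].length + I.n * I.n) = u by
    simp only [List.length_cons, List.length_nil]; omega]
  simp

theorem inNbhd_num (I : MaxHappyVertices) (v u : Fin I.n) :
    InNbhd I.num v u ↔ u = v ∨ I.G.Adj v u := by
  rw [InNbhd, num_row, Fin.val_inj]
  simp

/-- Every precolored vertex in the closed neighborhood of `v` has the color `j`. -/
def Compatible (I : MaxHappyVertices) (v : Fin I.n) (j : Fin I.ℓ) : Prop :=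
  ∀ u, u = v ∨ I.G.Adj v u → ∀ i, I.p u = some i → i = j

theorem compat_num (I : MaxHappyVertices) (v : Fin I.n) (j : Fin I.ℓ) :
    Compat I.num v j ↔ I.Compatible v j := by
  rw [Compat, num_zero, Compatible, ← Fin.forall_iff (p := fun u => InNbhd I.num v u →
    colorAt I.num u ≠ 0 → colorAt I.num u = j + 1)]
  refine forall_congr' fun u => imp_congr (I.inNbhd_num v u) ?_
  rw [colorAt_num]
  cases I.p u with
  | none => simp
  | some i =>
    simp only [Option.elim_some, Option.some.injEq, forall_eq']
    simp [Fin.ext_iff]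

/-! ### Happy vertices and compatible colors -/

/-- A happy vertex shares its color with its whole closed neighborhood, in particular with the
precolored vertices there. -/
theorem compatible_of_isHappy {I : MaxHappyVertices} {c : Fin I.n → Fin I.ℓ} (hc : Extends I.p c)
    {v : Fin I.n} (hv : IsHappy I.G c v) : I.Compatible v (c v) := by
  rintro u (rfl | hu) i hi
  · exact (hc u i hi).symm
  · rw [← hv u hu, hc u i hi]

theorem Compatible.mem_potentiallyHappy {I : MaxHappyVertices} {v : Fin I.n} {j : Fin I.ℓ}
    (h : I.Compatible v j) : v ∈ I.potentiallyHappy :=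
  fun u w hu hw i i' hi hi' => (h u hu i hi).trans (h w hw i' hi').symm

/-- Give `j` to every vertex that is not precolored. The closed neighborhood of a vertex compatible
with `j` then has color `j` throughout. -/
theorem isYes_of_le_ncard_compatible {I : MaxHappyVertices} {j : Fin I.ℓ}
    (h : I.k ≤ {v | I.Compatible v j}.ncard) : I.IsYes := by
  refine ⟨fun u => (I.p u).getD j, fun v i hi => by simp [hi], h.trans
    (Set.ncard_le_ncard (fun v hv => ?_) (Set.toFinite _))⟩
  have key : ∀ u, u = v ∨ I.G.Adj v u → (I.p u).getD j = j := by
    intro u hu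
    cases hp : I.p u with
    | none => rfl
    | some i => exact hv u hu i hp
  exact fun u hu => (key u (.inr hu)).trans (key v (.inl rfl)).symm

/-- Take the unique color seen in the closed neighborhood, or an arbitrary color if none is seen;
the latter needs `0 < ℓ`. -/
theorem exists_compatible {I : MaxHappyVertices} (hℓ : 0 < I.ℓ) {v : Fin I.n}
    (hv : v ∈ I.potentiallyHappy) : ∃ j, I.Compatible v j := by
  by_cases h : ∃ u, (u = v ∨ I.G.Adj v u) ∧ ∃ i, I.p u = some i
  · obtain ⟨u, hu, i, hi⟩ := h
    exact ⟨i, fun w hw i' hi' => hv w u hw hu i' i hi' hi⟩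
  · push Not at h
    exact ⟨⟨0, hℓ⟩, fun u hu i hi => absurd hi (h u hu i)⟩

theorem isYes_of_le_ncard_colored {I : MaxHappyVertices} {j : Fin I.ℓ}
    (h : I.k ≤ (I.potentiallyHappyColored j).ncard) : I.IsYes :=
  isYes_of_le_ncard_compatible (h.trans (Set.ncard_le_ncard
    (fun v hv u hu i hi => hv.1 u v hu (.inl rfl) i j hi hv.2) (Set.toFinite _)))

theorem isYes_of_le_ncard_uncolored {I : MaxHappyVertices} (hℓ : 0 < I.ℓ)
    (h : I.ℓ * I.k ≤ I.potentiallyHappyUncolored.ncard) : I.IsYes := by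
  classical
  have hex : ∀ v, ∃ j, v ∈ I.potentiallyHappy → I.Compatible v j := fun v => by
    by_cases hv : v ∈ I.potentiallyHappy
    · exact (exists_compatible hℓ hv).imp fun j hj _ => hj
    · exact ⟨⟨0, hℓ⟩, fun h => absurd h hv⟩
  choose f hf using hex
  rw [Set.ncard_eq_toFinset_card'] at h
  -- Pigeonhole on the chosen compatible colors: one of them serves at least `k` vertices.
  obtain ⟨j, -, hj⟩ := Finset.exists_le_card_fiber_of_mul_le_card_of_maps_to (f := f)
    (s := I.potentiallyHappyUncolored.toFinset) (t := Finset.univ) (fun _ _ => Finset.mem_univ _) ⟨⟨0, hℓ⟩, Finset.mem_univ _⟩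
    (by rwa [Finset.card_univ, Fintype.card_fin])
  refine isYes_of_le_ncard_compatible (j := j) (hj.trans ?_)
  rw [← Set.ncard_coe_finset]
  refine Set.ncard_le_ncard (fun v hv => ?_) (Set.toFinite _)
  obtain ⟨hv', rfl⟩ := Finset.mem_filter.1 (Finset.mem_coe.1 hv)
  exact hf v (Set.mem_toFinset.1 hv').1

theorem reducedGraph_adj {I : MaxHappyVertices} {v u : Fin I.n} (hv : v ∈ I.potentiallyHappy) :
    I.reducedGraph.Adj v u ↔ I.G.Adj v u := by
  simp only [reducedGraph, SimpleGraph.deleteEdges_adj, Set.mem_ofPred_eq, Sym2.mem_iff,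
    and_iff_left_iff_imp]
  exact fun _ h => h v (.inl rfl) hv

theorem isVertexCover_potentiallyHappy (I : MaxHappyVertices) :
    I.reducedGraph.IsVertexCover I.potentiallyHappy := by
  intro u v huv
  simp only [reducedGraph, SimpleGraph.deleteEdges_adj, Set.mem_ofPred_eq, Sym2.mem_iff] at huv
  by_contra! h
  refine huv.2 ?_
  rintro w (rfl | rfl)
  exacts [h.1, h.2]

/-- `P` is the union of `ℓ` color classes with fewer than `k` vertices each and of its vertices that
are not precolored. -/
theorem ncard_potentiallyHappy_le {I : MaxHappyVertices}
    (h : ∀ j, (I.potentiallyHappyColored j).ncard < I.k)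
    (h' : I.potentiallyHappyUncolored.ncard < I.ℓ * I.k) :
    I.potentiallyHappy.ncard ≤ 2 * I.ℓ * I.k := by
  classical
  have hsub : I.potentiallyHappy ⊆
      (⋃ j ∈ (Finset.univ : Finset (Fin I.ℓ)), I.potentiallyHappyColored j) ∪
        I.potentiallyHappyUncolored := by
    intro v hv
    cases hp : I.p v with
    | none => exact .inr ⟨hv, hp⟩
    | some j => exact .inl (Set.mem_biUnion (Finset.mem_univ j) ⟨hv, hp⟩)
  have h₁ : (⋃ j ∈ (Finset.univ : Finset (Fin I.ℓ)), I.potentiallyHappyColored j).ncard ≤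
      I.ℓ * I.k := by
    refine (Finset.set_ncard_biUnion_le _ _).trans ?_
    refine (Finset.sum_le_sum fun j _ => (h j).le).trans ?_
    simp
  have h₂ := (Set.ncard_le_ncard hsub (Set.toFinite _)).trans (Set.ncard_union_le _ _)
  have : 2 * I.ℓ * I.k = I.ℓ * I.k + I.ℓ * I.k := by ring
  omega

/-- For each extension the two sets of happy vertices coincide: happy vertices of `G` lie in `P`,
and vertices of `P` keep all their edges. -/
theorem isYes_iff_reducedGraph (I : MaxHappyVertices) :
    I.IsYes ↔ ∃ c, Extends I.p c ∧
      I.k ≤ {v | v ∈ I.potentiallyHappy ∧ IsHappy I.reducedGraph c v}.ncard := by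
  refine exists_congr fun c => and_congr_right fun hc => ?_
  suffices {v | IsHappy I.G c v} = {v | v ∈ I.potentiallyHappy ∧ IsHappy I.reducedGraph c v} by
    rw [this]
  ext v
  have key : v ∈ I.potentiallyHappy → (IsHappy I.reducedGraph c v ↔ IsHappy I.G c v) := fun hv =>
    forall_congr' fun u => by rw [reducedGraph_adj hv]
  exact ⟨fun h => ⟨(compatible_of_isHappy hc h).mem_potentiallyHappy,
    (key (compatible_of_isHappy hc h).mem_potentiallyHappy).2 h⟩, fun h => (key h.1).1 h.2⟩

/-! ### Correctness of the search -/

theorem exists_of_mem_pairs {I : MaxHappyVertices} {L : List (ℕ × ℕ)} (hL : IsPairs I.num L)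
    {p : ℕ × ℕ} (hp : p ∈ L) :
    ∃ (v : Fin I.n) (j : Fin I.ℓ), p = (v.val, j.val) ∧ I.Compatible v j := by
  obtain ⟨h₁, h₂, h₃⟩ := (hL.2 p).1 hp
  rw [num_zero] at h₁
  rw [num_one] at h₂
  exact ⟨⟨p.1, h₁⟩, ⟨p.2, h₂⟩, rfl, (I.compat_num ⟨p.1, h₁⟩ ⟨p.2, h₂⟩).1 h₃⟩

theorem mem_pairs {I : MaxHappyVertices} {L : List (ℕ × ℕ)} (hL : IsPairs I.num L)
    {v : Fin I.n} {j : Fin I.ℓ} (h : I.Compatible v j) : (v.val, j.val) ∈ L := by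
  rw [hL.2, num_zero, num_one, compat_num]
  exact ⟨v.isLt, j.isLt, h⟩

/-- Since `ℓ * k ≤ 2 ^ (k + ℓ)`, some color occurs in `k` pairs; these are distinct, hence so are
their vertices. -/
theorem isYes_of_many_pairs {I : MaxHappyVertices} {L : List (ℕ × ℕ)} (hL : IsPairs I.num L)
    (h : 2 ^ (I.k + I.ℓ) ≤ L.length) : I.IsYes := by
  classical
  have hpos : 0 < L.length := lt_of_lt_of_le (by positivity) h
  obtain ⟨v₀, j₀, -, -⟩ := exists_of_mem_pairs hL (List.getElem_mem hpos)
  have hle : I.ℓ * I.k ≤ L.length := by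
    refine le_trans ?_ h
    rw [pow_add, mul_comm]
    exact Nat.mul_le_mul Nat.lt_two_pow_self.le Nat.lt_two_pow_self.le
  obtain ⟨j, hj, hk⟩ := Finset.exists_le_card_fiber_of_mul_le_card_of_maps_to
    (s := L.toFinset) (f := Prod.snd) (t := Finset.range I.ℓ) (n := I.k) (fun p hp => by
      obtain ⟨v, j, rfl, -⟩ := exists_of_mem_pairs hL (List.mem_toFinset.1 hp)
      simp) ⟨j₀, by simp⟩ (by rwa [Finset.card_range, List.toFinset_card_of_nodup hL.1])
  refine isYes_of_le_ncard_compatible (j := ⟨j, Finset.mem_range.1 hj⟩) (hk.trans ?_)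
  rw [← Set.ncard_image_of_injective _ Fin.val_injective, ← Set.ncard_coe_finset]
  refine Set.ncard_le_ncard_of_injOn Prod.fst ?_ ?_ (Set.toFinite _)
  · intro p hp
    obtain ⟨hp, hpj⟩ := Finset.mem_filter.1 (Finset.mem_coe.1 hp)
    obtain ⟨v, j', rfl, hc⟩ := exists_of_mem_pairs hL (List.mem_toFinset.1 hp)
    obtain rfl : (j' : ℕ) = j := hpj
    exact ⟨v, hc, rfl⟩
  · intro p hp q hq hpq
    exact Prod.ext hpq ((Finset.mem_filter.1 (Finset.mem_coe.1 hp)).2.trans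
      (Finset.mem_filter.1 (Finset.mem_coe.1 hq)).2.symm)

/-- Each chosen vertex demands its color on its closed neighborhood. Without conflicts the demands
agree wherever they overlap, and compatibility makes them agree with `p`. -/
theorem isYes_of_not_bad {I : MaxHappyVertices} {L : List (ℕ × ℕ)} (hL : IsPairs I.num L)
    {g : ℕ → ℕ} (h : ¬ Bad I.num L g) : I.IsYes := by
  classical
  rw [Bad, num_two, num_zero] at h
  push Not at h
  obtain ⟨hg, hconf⟩ := h
  have hpair : ∀ a : Fin I.k, ∃ (v : Fin I.n) (j : Fin I.ℓ),
      L.getD (g a) (0, 0) = (v.val, j.val) ∧ I.Compatible v j := fun a => by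
    rw [List.getD_eq_getElem _ _ (hg a a.isLt)]
    exact exists_of_mem_pairs hL (List.getElem_mem _)
  choose v j hvj hc using hpair
  have hgood : ∀ a b u, a ≠ b → (u = v a ∨ I.G.Adj (v a) u) → (u = v b ∨ I.G.Adj (v b) u) →
      v a ≠ v b ∧ j a = j b := by
    intro a b u hab ha hb
    have := hconf a a.isLt b b.isLt u u.isLt (hg a a.isLt) (hg b b.isLt)
    rw [Conflict, hvj, hvj, inNbhd_num, inNbhd_num] at this
    simp only [ne_eq, Fin.val_inj] at this
    tauto
  -- Vertices outside all chosen neighborhoods get an arbitrary color; index `0` exists because `k`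
  -- is positive.
  let c : Fin I.n → Fin I.ℓ := fun u => (I.p u).getD
    (if h : ∃ a, u = v a ∨ I.G.Adj (v a) u then j h.choose else j ⟨0, I.k_pos⟩)
  have key : ∀ a u, (u = v a ∨ I.G.Adj (v a) u) → c u = j a := by
    intro a u hu
    cases hp : I.p u with
    | some i => simp [c, hp, hc a u hu i hp]
    | none =>
      have hex : ∃ a, u = v a ∨ I.G.Adj (v a) u := ⟨a, hu⟩
      simp only [c, hp, Option.getD_none, dif_pos hex]
      by_cases hab : hex.choose = a
      · rw [hab]
      · exact (hgood _ a u hab hex.choose_spec hu).2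
  refine ⟨c, fun u i hi => by simp [c, hi], ?_⟩
  have hinj : Function.Injective v := fun a b hab => by
    -- Equal vertices `v a = v b` would conflict at the common closed neighbor `v a` itself.
    by_contra hne
    exact (hgood a b (v a) hne (.inl rfl) (.inl hab)).1 hab
  calc I.k = (Set.range v).ncard := by
        rw [← Set.image_univ, Set.ncard_image_of_injective _ hinj]; simp
    _ ≤ _ := Set.ncard_le_ncard (by
        rintro _ ⟨a, rfl⟩
        exact fun u hu => (key a u (.inr hu)).trans (key a _ (.inl rfl)).symm) (Set.toFinite _)

/-- Select exactly `k` happy vertices. Their pairs with their colors occur in the list, at positions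
below `T` if the list is short, and these positions are the digits of the required number. -/
theorem IsYes.accepts {I : MaxHappyVertices} (h : I.IsYes) {L : List (ℕ × ℕ)}
    (hL : IsPairs I.num L) : Accepts I.num L := by
  classical
  rw [Accepts, num_one, num_two]
  refine or_iff_not_imp_left.2 fun hlen => ?_
  obtain ⟨c, hc, hk⟩ := h
  rw [Set.ncard_eq_toFinset_card'] at hk
  obtain ⟨S, hS, hSk⟩ := Finset.exists_subset_card_eq hk
  let e := S.equivFinOfCardEq hSk
  have happy : ∀ a, IsHappy I.G c (e.symm a) := fun a => Set.mem_toFinset.1 (hS (e.symm a).2)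
  have hmem : ∀ a : Fin I.k, ∃ i, ∃ h : i < L.length,
      L[i] = ((e.symm a).1.val, (c (e.symm a)).val) := fun a =>
    List.getElem_of_mem (mem_pairs hL (compatible_of_isHappy hc (happy a)))
  choose g hg hgL using hmem
  obtain ⟨x, hx, hxd⟩ := Nat.exists_lt_pow_digits (T := 2 ^ (I.k + I.ℓ)) (k := I.k)
    (fun a => if h : a < I.k then g ⟨a, h⟩ else 0) fun a ha => by
      rw [dif_pos ha]
      exact (hg _).trans (not_le.1 hlen)
  have hxd' : ∀ a : Fin I.k, x / (2 ^ (I.k + I.ℓ)) ^ (a : ℕ) % 2 ^ (I.k + I.ℓ) = g a := fun a => by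
    rw [hxd a a.isLt, dif_pos a.isLt]
  refine ⟨x, hx, ?_⟩
  rw [Bad, num_two, num_zero]
  rintro (⟨a, ha, hle⟩ | ⟨a, ha, b, hb, u, hu, -, -, hab, h₁, h₂, h₃⟩)
  · exact absurd (hg ⟨a, ha⟩) (not_lt.2 (hxd' ⟨a, ha⟩ ▸ hle))
  · have hga := hxd' ⟨a, ha⟩
    have hgb := hxd' ⟨b, hb⟩
    dsimp only at hga hgb h₁ h₂ h₃
    rw [hga, List.getD_eq_getElem _ _ (hg _), hgL] at h₁ h₃
    rw [hgb, List.getD_eq_getElem _ _ (hg _), hgL] at h₂ h₃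
    -- A vertex in two of the closed neighborhoods has the color of both happy vertices, so these
    -- colors cannot differ.
    have hcol : ∀ a, InNbhd I.num (e.symm a).1 u → c ⟨u, hu⟩ = c (e.symm a) := by
      intro a h
      rcases (I.inNbhd_num _ ⟨u, hu⟩).1 h with h | h
      · rw [h]
      · exact happy a _ h
    rcases h₃ with h₃ | h₃
    · have := e.symm.injective (Subtype.ext (Fin.ext h₃))
      exact hab (congrArg Fin.val this)
    · exact h₃ (by rw [← hcol _ h₁, ← hcol _ h₂])

theorem accepts_iff_isYes {I : MaxHappyVertices} {L : List (ℕ × ℕ)} (hL : IsPairs I.num L) :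
    Accepts I.num L ↔ I.IsYes := by
  refine ⟨?_, fun h => h.accepts hL⟩
  rintro (h | ⟨x, -, h⟩)
  · rw [num_one, num_two] at h
    exact isYes_of_many_pairs hL h
  · exact isYes_of_not_bad hL h

/-- Every number contributes at least its separator. -/
theorem length_numbers_le_length_encode (I : MaxHappyVertices) :
    I.numbers.length ≤ I.encode.length := by
  rw [encode, List.length_flatMap]
  simp [List.sum_map_add]

end MaxHappyVertices

/-! ### The time bound: quadratic in the input length, computable in the parameter -/

namespace RAM

theorem totalTime_mono {len n ℓ k len' n' ℓ' k' : ℕ} (h₁ : len ≤ len') (h₂ : n ≤ n')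
    (h₃ : ℓ ≤ ℓ') (h₄ : k ≤ k') : totalTime len n ℓ k ≤ totalTime len' n' ℓ' k' := by
  unfold totalTime roundTime
  gcongr <;> first | omega | exact Nat.one_le_two_pow

/-- The time is a polynomial in `N` of degree at most two with nonnegative coefficients. After
substituting `N = 1 + M`, the difference of the two sides has nonnegative coefficients in `M`. -/
theorem totalTime_le_sq {N : ℕ} (hN : 1 ≤ N) (ℓ k : ℕ) :
    totalTime N N ℓ k ≤ totalTime 1 1 ℓ k * N ^ 2 := by
  unfold totalTime roundTime
  generalize (2 ^ (k + ℓ)) ^ k = X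
  generalize readLetter.time = c₁, readHeader.time = c₂, storeRow.time = c₃, clashE.cost = c₄,
    appendPair.time = c₅, Expr.cost _ = c₆, divStep.time = c₇, Expr.cost _ = c₈,
    conflictE.cost = c₉, Expr.cost _ = c₁₀
  obtain ⟨M, rfl⟩ := Nat.exists_eq_add_of_le hN
  zify
  rw [← sub_nonneg]
  ring_nf
  positivity

theorem primrec_add {f g : ℕ → ℕ} (hf : Primrec f) (hg : Primrec g) :
    Primrec fun m => f m + g m := Primrec.nat_add.comp hf hg

theorem primrec_mul {f g : ℕ → ℕ} (hf : Primrec f) (hg : Primrec g) :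
    Primrec fun m => f m * g m := Primrec.nat_mul.comp hf hg

theorem primrec_pow {f g : ℕ → ℕ} (hf : Primrec f) (hg : Primrec g) :
    Primrec fun m => f m ^ g m :=
  (Primrec₂.unpaired'.1 Nat.Primrec.pow).comp hf hg

theorem computable_totalTime : Computable fun m => totalTime 1 1 m m := by
  refine Primrec.to_comp ?_
  unfold totalTime roundTime
  repeat' first
    | exact Primrec.const _
    | exact Primrec.id
    | apply primrec_add
    | apply primrec_mul
    | apply primrec_pow

end RAM

theorem MaxHappyVertices.fixedParameterTractable :
    FixedParameterTractable MaxHappyVertices.encode (fun I => I.k + I.ℓ)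
      MaxHappyVertices.IsYes := by
  refine ⟨RAM.decideProgram, fun m => RAM.totalTime 1 1 m m, 2, RAM.computable_totalTime,
    fun I => ?_⟩
  obtain ⟨t, s, he, ht, L, hL, hs⟩ := RAM.run_decideProgram I.numbers I.num rfl I.encode rfl
  refine ⟨t, s, he, ht.trans ?_, hs.trans (accepts_iff_isYes hL)⟩
  have hlen := I.length_numbers_le_length_encode
  rw [I.length_numbers] at hlen
  rw [I.num_zero, I.num_one, I.num_two]
  -- The order `n` is at most the input length, and `k` and `ℓ` are at most the parameter `k + ℓ`.
  exact (RAM.totalTime_mono le_rfl (by omega) (Nat.le_add_left _ _) (Nat.le_add_right _ _)).trans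
    (RAM.totalTime_le_sq (by omega) _ _)

theorem mainTheorem5 :
    FixedParameterTractable MaxHappyVertices.encode (fun I => I.k + I.ℓ)
      MaxHappyVertices.IsYes ∧
    ∀ I : MaxHappyVertices, 0 < I.ℓ →
      ((∃ j, I.k ≤ (I.potentiallyHappyColored j).ncard) → I.IsYes) ∧
      (I.ℓ * I.k ≤ I.potentiallyHappyUncolored.ncard → I.IsYes) ∧
      (∀ c, Extends I.p c → ∀ v, IsHappy I.G c v → v ∈ I.potentiallyHappy) ∧
      ((∀ j, (I.potentiallyHappyColored j).ncard < I.k) →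
        I.potentiallyHappyUncolored.ncard < I.ℓ * I.k →
          I.reducedGraph.IsVertexCover I.potentiallyHappy ∧
          I.potentiallyHappy.ncard ≤ 2 * I.ℓ * I.k) ∧
      (I.IsYes ↔ ∃ c, Extends I.p c ∧
        I.k ≤ {v | v ∈ I.potentiallyHappy ∧ IsHappy I.reducedGraph c v}.ncard) := by
  refine ⟨MaxHappyVertices.fixedParameterTractable, fun I hℓ => ⟨?_, ?_, ?_, ?_, ?_⟩⟩
  · exact fun ⟨_, hj⟩ => MaxHappyVertices.isYes_of_le_ncard_colored hj
  · exact MaxHappyVertices.isYes_of_le_ncard_uncolored hℓ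
  · exact fun c hc v hv =>
      (MaxHappyVertices.compatible_of_isHappy hc hv).mem_potentiallyHappy
  · exact fun h h' => ⟨I.isVertexCover_potentiallyHappy,
      MaxHappyVertices.ncard_potentiallyHappy_le h h'⟩
  · exact I.isYes_iff_reducedGraph
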